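/- All graphs are finite and simple. A bridge of a connected graph is an edge whose removal disconnects it; a connected graph is biconnected if it has no bridge but the removal of some edge creates one (2-edge-connected, not 3-edge-connected); a bi-bridge of such a graph is a set of two edges whose removal disconnects it. Two edges of a graph $H$ are distinct if no automorphism of $H$ maps one to the other. Construction. Let $G$ be a biconnected cubic graph on $n$ vertices. Choose a bi-bridge $\{a_1b_1,a_2b_2\}$ of $G$ that partitions the vertices as evenly as possible into two parts, and call $G_1$ a part whose induced subgraph contains at least as many pairwise distinct edges on cycles (distinctness and cycles taken in that induced subgraph) as the other one; name the ends so that $b_1,b_2\in G_1$. Delete $a_1b_1,a_2b_2$ and add four vertices $n_1,n_2,n_3,n_4$ and the edges $a_1n_1,\ a_2n_1,\ n_1n_2,\ n_2n_3,\ n_2n_4,\ n_3b_1,\ n_4b_2$. Call the result $G'$, and let $G_1'$ be its subgraph induced on $G_1\cup\{n_2,n_3,n_4\}$. From each $\mathrm{Aut}(G_1')$-class of edges of $G_1'$ that lie on a cycle of $G_1'$ and avoid $n_3,n_4$ choose one edge $xy$ and an order of its ends such that $xn_3$ and $yn_4$ are not edges of $G'$; delete $xy$ from $G'$ and add $xn_3$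 and $yn_4$. So there is one output graph for each class. Theorem 4.3. 1. The construction can be carried out on every biconnected cubic graph $G$ on $n$ vertices. 2. Whatever choices are made, every output is a connected cubic graph on $n+4$ vertices with a bridge. 3. For every $M$ there is an $N$ such that for all $n\ge N$, every biconnected cubic graph $G$ on $n$ vertices and all choices, $G_1'$ has at least $M$ pairwise distinct edges on cycles. 4. For every $M$ there is an $N$ such that for all $n\ge N$ the following holds. Let $(G_i)_{i\in I}$ be pairwise non-isomorphic biconnected cubic graphs on $n$ vertices (for instance one from each isomorphism class), and carry out the construction on each of them, with arbitrary choices. Then one can select exactly $M$ of the outputs of each $G_i$ so that all the selected graphs are pairwise non-isomorphic, both those from the same $G_i$ and those from different ones. -/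

import Mathlib

namespace BridgeConstruction

/-- Every vertex has exactly three neighbours. -/
def IsCubic {V : Type*} (G : SimpleGraph V) : Prop :=
  ∀ v, (G.neighborSet v).ncard = 3

/-- The graph contains at least one bridge: an edge whose removal disconnects the graph
(for a connected graph, this is Mathlib's `IsBridge`, a cut edge). -/
def HasBridge {V : Type*} (G : SimpleGraph V) : Prop :=
  ∃ e ∈ G.edgeSet, G.IsBridge e

/-- A connected graph without bridges in which the removal of some edge creates a bridge. -/
structure IsBiconnected {V : Type*} (G : SimpleGraph V) : Prop where
  connected : G.Connected
  bridgeless : ¬ HasBridge G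
  exists_edge : ∃ e ∈ G.edgeSet, HasBridge (G.deleteEdges {e})

/-- A bi-bridge: a set `{e, f}` of two edges whose removal disconnects the graph. -/
structure IsBibridge {V : Type*} (G : SimpleGraph V) (e f : Sym2 V) : Prop where
  left_mem : e ∈ G.edgeSet
  right_mem : f ∈ G.edgeSet
  ne : e ≠ f
  disconnects : ¬ (G.deleteEdges {e, f}).Connected

/-- `S` is one of the parts (connected components) left after removing the edges `e` and `f`.
In a connected bridgeless graph a bi-bridge leaves exactly two parts, `S` and its complement. -/
def IsPart {V : Type*} (G : SimpleGraph V) (e f : Sym2 V) (S : Set V) : Prop :=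
  ∃ c : (G.deleteEdges {e, f}).ConnectedComponent, c.supp = S

/-- How far the partition of the vertices into `S` and its complement is from being even. -/
noncomputable def imbalance {V : Type*} (S : Set V) : ℕ :=
  ((S.ncard : ℤ) - (Sᶜ.ncard : ℤ)).natAbs

/-- The edges of `H` that lie on a cycle of `H`. -/
def cycleEdges {W : Type*} (H : SimpleGraph W) : Set (Sym2 W) :=
  {e | ∃ (u : W) (p : H.Walk u u), p.IsCycle ∧ e ∈ p.edges}

/-- Some automorphism of `H` maps `e` to `f`; edges are *distinct* when this fails. -/
def Similar {W : Type*} (H : SimpleGraph W) (e f : Sym2 W) : Prop :=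
  ∃ φ : H ≃g H, e.map φ = f

/-- The number of pairwise distinct edges of `H` on cycles, i.e. the number of automorphism
classes of such edges. -/
noncomputable def numDistinctCycleEdges {W : Type*} (H : SimpleGraph W) : ℕ :=
  ((fun e => {f | Similar H e f}) '' cycleEdges H).ncard

/-- A choice of a bi-bridge `{a₁b₁, a₂b₂}` of `G` that partitions the vertices as evenly as
possible, together with the vertex set `side` of the part `G₁` with more distinct edges on
cycles (ties are broken arbitrarily); `b₁`, `b₂` are the ends of the bi-bridge in that part. -/
structure Split {V : Type*} (G : SimpleGraph V) where
  a₁ : V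
  b₁ : V
  a₂ : V
  b₂ : V
  bibridge : IsBibridge G s(a₁, b₁) s(a₂, b₂)
  side : Set V
  isPart : IsPart G s(a₁, b₁) s(a₂, b₂) side
  a₁_notMem : a₁ ∉ side
  b₁_mem : b₁ ∈ side
  a₂_notMem : a₂ ∉ side
  b₂_mem : b₂ ∈ side
  most_even : ∀ (e f : Sym2 V) (S : Set V), IsBibridge G e f → IsPart G e f S →
    imbalance side ≤ imbalance S
  more_distinct : numDistinctCycleEdges (G.induce sideᶜ) ≤ numDistinctCycleEdges (G.induce side)

namespace Split

variable {V : Type*} {G : SimpleGraph V}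

/-- The graph `G'`: the two edges of the bi-bridge are removed and four vertices
`n₁, n₂, n₃, n₄` (here `inr 0, inr 1, inr 2, inr 3`) are added, with the edges
`a₁n₁, a₂n₁, n₁n₂, n₂n₃, n₂n₄, n₃b₁, n₄b₂`. -/
def splitGraph (s : Split G) : SimpleGraph (V ⊕ Fin 4) :=
  (G.deleteEdges {s(s.a₁, s.b₁), s(s.a₂, s.b₂)}).map Function.Embedding.inl ⊔
    SimpleGraph.fromEdgeSet
      {s(.inl s.a₁, .inr 0), s(.inl s.a₂, .inr 0), s(.inr 0, .inr 1), s(.inr 1, .inr 2),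
        s(.inr 1, .inr 3), s(.inr 2, .inl s.b₁), s(.inr 3, .inl s.b₂)}

/-- The vertices of `G₁'`, the part of `G'` beyond the bridge `n₁n₂` that contains `G₁`. -/
def extSide (s : Split G) : Set (V ⊕ Fin 4) :=
  Sum.inl '' s.side ∪ {.inr 1, .inr 2, .inr 3}

/-- The graph `G₁'`. -/
def extGraph (s : Split G) : SimpleGraph s.extSide :=
  s.splitGraph.induce s.extSide

/-- The edges of `G₁'` that can be used in the edge insertion: they lie on a cycle and do not
contain the two vertices `n₃`, `n₄` of degree two, which are to be joined to their ends. -/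
def candidateEdges (s : Split G) : Set (Sym2 s.extSide) :=
  {e | e ∈ cycleEdges s.extGraph ∧ ∀ v ∈ e, v.1 ≠ .inr 2 ∧ v.1 ≠ .inr 3}

/-- The graph obtained from `G'` by removing the edge `xy` of `G₁'` and joining `x` to `n₃` and
`y` to `n₄`. -/
def insertion (s : Split G) (d : s.extGraph.Dart) : SimpleGraph (V ⊕ Fin 4) :=
  s.splitGraph.deleteEdges {s(d.fst.1, d.snd.1)} ⊔
    SimpleGraph.fromEdgeSet {s(d.fst.1, .inr 2), s(d.snd.1, .inr 3)}

/-- The ordered edge `xy` is admissible: `xy` is a candidate edge, and joining `x` to `n₃` and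
`y` to `n₄` does not double an edge that is already present. -/
structure Admissible (s : Split G) (d : s.extGraph.Dart) : Prop where
  mem : d.edge ∈ s.candidateEdges
  fst_not_adj : ¬ s.splitGraph.Adj d.fst.1 (.inr 2)
  snd_not_adj : ¬ s.splitGraph.Adj d.snd.1 (.inr 3)

end Split

/-- A full set of choices in the construction applied to `G`: a split, and for each automorphism
class of candidate edges of `G₁'` one edge of the class with one admissible order of its ends. -/
structure Run {V : Type*} (G : SimpleGraph V) extends Split G where
  darts : Set toSplit.extGraph.Dart
  admissible : ∀ d ∈ darts, toSplit.Admissible d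
  existsUnique : ∀ e ∈ toSplit.candidateEdges,
    ∃! d : toSplit.extGraph.Dart, d ∈ darts ∧ Similar toSplit.extGraph e d.edge

/-- The graph produced from the chosen ordered edge `d`. -/
def Run.output {V : Type*} {G : SimpleGraph V} (r : Run G) (d : r.toSplit.extGraph.Dart) :
    SimpleGraph (V ⊕ Fin 4) :=
  r.toSplit.insertion d

end BridgeConstruction

/-! The graph `G'` and every output arise from `G` by cutting a few edges open and attaching their
loose ends to the star `n₁, n₂, n₃, n₄`. As the star is connected, a path of `G` can be rerouted
through it, so the result is connected and each surviving edge of `G` still lies on a cycle. The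
edge `n₁n₂` is the only one that leaves the side of `n₂`, so it is a bridge.

In a connected graph of maximum degree `D` the ball of radius `k` around an automorphism-invariant
set `T` has at most `|T| (D + 1) ^ k` vertices. Edges that leave balls of different radii are
distinct, so a large graph has many distinct edges. With `T` the vertices of degree `2`, this
applies to `G₁'` if `G₁` is large. If `G₁` is small, the other part has no bridge, since a bridge
there would give a more even bi-bridge. The argument then applies to the other part, which would
have more distinct edges on cycles than `G₁` has edges, against the choice of `G₁`.

An isomorphism between outputs maps some `nᵢ` to some `nⱼ`: otherwise the bridge `n₁n₂` would be
mapped to an edge of `G`, which lies on a cycle. It therefore maps the labels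
`a₁, b₁, a₂, b₂, x, y, n₁, n₂, n₃, n₄` into the ball of radius `3` around `n₁, n₂, n₃, n₄`. If two
outputs have their labels mapped to the same vertices, the resulting isomorphism of the outputs
respects labels and restricts to one of the source graphs, so the outputs come from the same graph
and the same class of edges. Hence at most `256 ^ 10` outputs are isomorphic to a given one, and
Hall's marriage theorem selects `M` outputs from every source graph.
-/

namespace BridgeConstruction

open SimpleGraph

section Cuts

variable {V W : Type*} {G : SimpleGraph V} {H : SimpleGraph W}

lemma reachable_map_of_adj (f : V → W) (hf : ∀ u v, G.Adj u v → H.Reachable (f u) (f v))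
    {u v : V} (h : G.Reachable u v) : H.Reachable (f u) (f v) := by
  obtain ⟨p⟩ := h
  induction p with
  | nil => exact .rfl
  | cons h _ ih => exact (hf _ _ h).trans ih

/-- The edges of `G` between `X` and `Y`, as ordered pairs with the first end in `X`; for
`Y = Xᶜ` this is the cut of `X`. -/
def crossing (G : SimpleGraph V) (X Y : Set V) : Set (V × V) :=
  {p | p.1 ∈ X ∧ p.2 ∈ Y ∧ G.Adj p.1 p.2}

@[simp] lemma mem_crossing {X Y : Set V} {u v : V} :
    (u, v) ∈ crossing G X Y ↔ u ∈ X ∧ v ∈ Y ∧ G.Adj u v := Iff.rfl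

lemma image_swap_crossing (X Y : Set V) : Prod.swap '' crossing G X Y = crossing G Y X := by
  ext ⟨u, v⟩
  simp only [Set.image_swap_eq_preimage_swap, Set.mem_preimage, Prod.swap_prod_mk, mem_crossing,
    G.adj_comm v u]
  tauto

lemma ncard_crossing_comm (X Y : Set V) : (crossing G X Y).ncard = (crossing G Y X).ncard := by
  rw [← image_swap_crossing, Set.ncard_image_of_injective _ Prod.swap_injective]

lemma ncard_crossing_union_left [Finite V] {X X' : Set V} (h : Disjoint X X') (Y : Set V) :
    (crossing G (X ∪ X') Y).ncard = (crossing G X Y).ncard + (crossing G X' Y).ncard := by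
  rw [← Set.ncard_union_eq]
  · congr 1
    ext ⟨u, v⟩
    simp only [mem_crossing, Set.mem_union]
    tauto
  · exact Set.disjoint_left.2 fun p hp hp' => h.notMem_of_mem_left hp.1 hp'.1

lemma ncard_crossing_union_right [Finite V] (X : Set V) {Y Y' : Set V} (h : Disjoint Y Y') :
    (crossing G X (Y ∪ Y')).ncard = (crossing G X Y).ncard + (crossing G X Y').ncard := by
  simp only [ncard_crossing_comm X, ncard_crossing_union_left h]

lemma ncard_crossing_compl_add_ncard_crossing_compl [Finite V] {A B : Set V} (h : Disjoint A B) :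
    (crossing G A Aᶜ).ncard + (crossing G B Bᶜ).ncard =
      (crossing G (A ∪ B) (A ∪ B)ᶜ).ncard + 2 * (crossing G A B).ncard := by
  have hA : Aᶜ = B ∪ (A ∪ B)ᶜ := by
    ext v
    simp only [Set.mem_compl_iff, Set.mem_union]
    have : v ∈ A → v ∉ B := fun hv => h.notMem_of_mem_left hv
    tauto
  have hB : Bᶜ = A ∪ (A ∪ B)ᶜ := by
    ext v
    simp only [Set.mem_compl_iff, Set.mem_union]
    have : v ∈ A → v ∉ B := fun hv => h.notMem_of_mem_left hv
    tauto
  have hA' : Disjoint A (A ∪ B)ᶜ := disjoint_compl_right.mono_left Set.subset_union_left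
  have hB' : Disjoint B (A ∪ B)ᶜ := disjoint_compl_right.mono_left Set.subset_union_right
  rw [hA, hB, ncard_crossing_union_right _ hB', ncard_crossing_union_right _ hA',
    ncard_crossing_union_left h, ncard_crossing_comm B A]
  ring

lemma exists_mem_crossing_compl {u v : V} (h : G.Reachable u v) {X : Set V} (hu : u ∈ X)
    (hv : v ∉ X) : ∃ p, p ∈ crossing G X Xᶜ := by
  obtain ⟨p⟩ := h
  obtain ⟨d, -, h₁, h₂⟩ := p.exists_boundary_dart X hu hv
  exact ⟨d.toProd, h₁, h₂, d.adj⟩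

lemma isBridge_iff_exists_crossing_eq {u v : V} (huv : G.Adj u v) :
    G.IsBridge s(u, v) ↔ ∃ X, crossing G X Xᶜ = {(u, v)} := by
  rw [isBridge_iff]
  constructor
  · intro h
    refine ⟨{w | (G.deleteEdges {s(u, v)}).Reachable u w}, Set.eq_singleton_iff_unique_mem.2
      ⟨⟨.rfl, h, huv⟩, ?_⟩⟩
    rintro ⟨x, y⟩ ⟨hx, hy, hxy⟩
    have hxy' : s(x, y) = s(u, v) := by
      by_contra hne
      exact hy (hx.trans (deleteEdges_adj.2 ⟨hxy, hne⟩).reachable)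
    rcases Sym2.eq_iff.1 hxy' with ⟨rfl, rfl⟩ | ⟨rfl, rfl⟩
    · rfl
    · exact (h hx).elim
  · rintro ⟨X, hX⟩ h
    have huX : (u, v) ∈ crossing G X Xᶜ := hX ▸ rfl
    obtain ⟨⟨x, y⟩, hx, hy, hxy⟩ := exists_mem_crossing_compl h huX.1 huX.2.1
    rw [deleteEdges_adj] at hxy
    have : (x, y) ∈ crossing G X Xᶜ := ⟨hx, hy, hxy.1⟩
    rw [hX, Set.mem_singleton_iff, Prod.mk.injEq] at this
    exact hxy.2 (by simp [this])

lemma not_hasBridge_iff_isEdgeConnected_two (hG : G.Connected) :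
    ¬ HasBridge G ↔ G.IsEdgeConnected 2 := by
  rw [isEdgeConnected_two]
  refine ⟨fun h e => ?_, ?_⟩
  · by_cases he : e ∈ G.edgeSet
    · induction e with | h u v
      have : ¬ G.IsBridge s(u, v) := fun hb => h ⟨_, he, hb⟩
      exact (hG.connected_delete_edge_of_not_isBridge this).preconnected
    · rw [deleteEdges_eq_self.2 (by simpa using he)]
      exact hG.preconnected
  · rintro h ⟨e, -, hb⟩
    induction e with | h u v
    exact isBridge_iff.1 hb (h _ u v)

lemma IsBiconnected.isEdgeConnected_two (hG : IsBiconnected G) : G.IsEdgeConnected 2 :=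
  (not_hasBridge_iff_isEdgeConnected_two hG.connected).1 hG.bridgeless

lemma not_isBridge (hG : G.IsEdgeConnected 2) {u v : V} (huv : G.Adj u v) :
    ¬ G.IsBridge s(u, v) := by
  have : Nonempty V := ⟨u⟩
  exact fun h => (not_hasBridge_iff_isEdgeConnected_two (hG.connected two_ne_zero)).2 hG ⟨_, huv, h⟩

lemma crossing_compl_nontrivial (hG : G.IsEdgeConnected 2) {X : Set V} (hX : X.Nonempty)
    (hX' : Xᶜ.Nonempty) : (crossing G X Xᶜ).Nontrivial := by
  obtain ⟨u, hu⟩ := hX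
  obtain ⟨v, hv⟩ := hX'
  obtain ⟨⟨x, y⟩, hxy⟩ := exists_mem_crossing_compl (hG.preconnected two_ne_zero u v) hu hv
  by_contra h
  exact not_isBridge hG hxy.2.2 ((isBridge_iff_exists_crossing_eq hxy.2.2).2
    ⟨X, (Set.not_nontrivial_iff.1 h).eq_singleton_of_mem hxy⟩)

lemma exists_crossing_sdiff_eq_singleton {P : Set V} (h : HasBridge (G.induce P)) :
    ∃ A ⊆ P, ∃ p, crossing G A (P \ A) = {p} := by
  obtain ⟨e, he, hb⟩ := h
  induction e with | h u v
  have huv : (G.induce P).Adj u v := he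
  obtain ⟨X, hX⟩ := (isBridge_iff_exists_crossing_eq huv).1 hb
  refine ⟨Subtype.val '' X, by simp, (u.1, v.1), ?_⟩
  rw [← Prod.map_apply, ← Set.image_singleton, ← hX]
  ext ⟨x, y⟩
  constructor
  · rintro ⟨⟨x, hx, rfl⟩, ⟨hyP, hy⟩, hxy⟩
    exact ⟨(x, ⟨y, hyP⟩), ⟨hx, fun hyX => hy ⟨_, hyX, rfl⟩, hxy⟩, rfl⟩
  · rintro ⟨⟨x, y⟩, ⟨hx, hy, hxy⟩, ⟨⟩⟩
    exact ⟨⟨x, hx, rfl⟩, ⟨y.2, fun ⟨z, hz, hzy⟩ => hy (Subtype.val_injective hzy ▸ hz)⟩, hxy⟩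

end Cuts

section TwoCuts

variable {V : Type*} {G : SimpleGraph V} {S : Set V} {a₁ b₁ a₂ b₂ : V}

/-- The cut of `S` consists of the two edges `b₁a₁` and `b₂a₂`, where `b₁, b₂ ∈ S`; the letters
are those of the bi-bridge `{a₁b₁, a₂b₂}` in the construction. -/
structure IsTwoCut (G : SimpleGraph V) (S : Set V) (a₁ b₁ a₂ b₂ : V) : Prop where
  crossing_eq : crossing G S Sᶜ = {(b₁, a₁), (b₂, a₂)}
  ne : (b₁, a₁) ≠ (b₂, a₂)

lemma exists_isTwoCut_of_ncard_crossing (h : (crossing G S Sᶜ).ncard = 2) :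
    ∃ a₁ b₁ a₂ b₂, IsTwoCut G S a₁ b₁ a₂ b₂ := by
  obtain ⟨⟨b₁, a₁⟩, ⟨b₂, a₂⟩, hne, h⟩ := Set.ncard_eq_two.1 h
  exact ⟨a₁, b₁, a₂, b₂, h, hne⟩

namespace IsTwoCut

lemma mem_crossing₁ (h : IsTwoCut G S a₁ b₁ a₂ b₂) : (b₁, a₁) ∈ crossing G S Sᶜ := by
  simp [h.crossing_eq]

lemma mem_crossing₂ (h : IsTwoCut G S a₁ b₁ a₂ b₂) : (b₂, a₂) ∈ crossing G S Sᶜ := by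
  simp [h.crossing_eq]

lemma compl (h : IsTwoCut G S a₁ b₁ a₂ b₂) : IsTwoCut G Sᶜ b₁ a₁ b₂ a₂ where
  crossing_eq := by
    rw [compl_compl, ← image_swap_crossing, h.crossing_eq, Set.image_pair]
    simp only [Prod.swap_prod_mk]
  ne h' := h.ne (Prod.swap_injective h')

lemma eq_or_eq_of_adj (h : IsTwoCut G S a₁ b₁ a₂ b₂) {u v : V} (hu : u ∈ S) (hv : v ∉ S)
    (huv : G.Adj u v) : u = b₁ ∧ v = a₁ ∨ u = b₂ ∧ v = a₂ := by
  have : (u, v) ∈ crossing G S Sᶜ := ⟨hu, hv, huv⟩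
  simpa [h.crossing_eq] using this

lemma ncard_crossing (h : IsTwoCut G S a₁ b₁ a₂ b₂) : (crossing G S Sᶜ).ncard = 2 := by
  rw [h.crossing_eq, Set.ncard_pair h.ne]

lemma edge_ne (h : IsTwoCut G S a₁ b₁ a₂ b₂) : s(a₁, b₁) ≠ s(a₂, b₂) := by
  intro he
  rcases Sym2.eq_iff.1 he with ⟨rfl, rfl⟩ | ⟨rfl, rfl⟩
  · exact h.ne rfl
  · exact h.mem_crossing₁.2.1 h.mem_crossing₂.1

/-- Were `a₁ = a₂ = a`, only the third edge at `a` would leave `S ∪ {a}`. -/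
lemma a_ne (h : IsTwoCut G S a₁ b₁ a₂ b₂) (hG : G.IsEdgeConnected 2) (h3 : IsCubic G) :
    a₁ ≠ a₂ := by
  rintro rfl
  have hb : b₁ ≠ b₂ := fun hb => h.ne (by rw [hb])
  have hsub : {b₁, b₂} ⊆ G.neighborSet a₁ :=
    Set.pair_subset h.mem_crossing₁.2.2.symm h.mem_crossing₂.2.2.symm
  obtain ⟨c, hc⟩ : ∃ c, G.neighborSet a₁ \ {b₁, b₂} = {c} := by
    rw [← Set.ncard_eq_one, Set.ncard_sdiff hsub (by simp), h3, Set.ncard_pair hb]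
  have hcut : crossing G (insert a₁ S) (insert a₁ S)ᶜ ⊆ {(a₁, c)} := by
    rintro ⟨u, v⟩ ⟨hu, hv, huv⟩
    simp only [Set.mem_compl_iff, Set.mem_insert_iff, not_or] at hu hv
    rcases hu with rfl | hu
    · have hv' : v ∈ G.neighborSet u \ {b₁, b₂} := by
        refine ⟨huv, ?_⟩
        rintro (rfl | rfl)
        exacts [hv.2 h.mem_crossing₁.1, hv.2 h.mem_crossing₂.1]
      rw [hc] at hv'
      rw [Set.mem_singleton_iff.1 hv', Set.mem_singleton_iff]
    · rcases h.eq_or_eq_of_adj hu hv.2 huv with h' | h' <;> exact (hv.1 h'.2).elim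
  have hcmem : c ∈ G.neighborSet a₁ \ {b₁, b₂} := hc ▸ rfl
  have hcS : c ∉ S := fun hcS => hcmem.2 <| by
    rcases h.eq_or_eq_of_adj hcS h.mem_crossing₁.2.1 hcmem.1.symm with h' | h' <;> simp [h'.1]
  exact Set.not_nontrivial_singleton ((crossing_compl_nontrivial hG ⟨a₁, by simp⟩
    ⟨c, by simp [hcS, hcmem.1.ne']⟩).mono hcut)

lemma b_ne (h : IsTwoCut G S a₁ b₁ a₂ b₂) (hG : G.IsEdgeConnected 2) (h3 : IsCubic G) :
    b₁ ≠ b₂ :=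
  h.compl.a_ne hG h3

lemma b₁_mem_of_forall_adj (h : IsTwoCut G S a₁ b₁ a₂ b₂) (hG : G.IsEdgeConnected 2) {X : Set V}
    (hXS : X ⊆ S) (hX : X.Nonempty) (hadj : ∀ u ∈ X, ∀ v ∈ S, G.Adj u v → v ∈ X) : b₁ ∈ X := by
  have hsub : crossing G X Xᶜ ⊆ crossing G S Sᶜ := fun p hp =>
    ⟨hXS hp.1, fun hpS => hp.2.1 (hadj _ hp.1 _ hpS hp.2.2), hp.2.2⟩
  have hX' : Xᶜ.Nonempty := ⟨a₁, fun ha => h.mem_crossing₁.2.1 (hXS ha)⟩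
  obtain ⟨p, hp, hne⟩ := (crossing_compl_nontrivial hG hX hX').exists_ne (b₂, a₂)
  have := h.crossing_eq ▸ hsub hp
  obtain rfl := (Set.mem_insert_iff.1 this).resolve_right hne
  exact hp.1

lemma connected_induce (h : IsTwoCut G S a₁ b₁ a₂ b₂) (hG : G.IsEdgeConnected 2) :
    (G.induce S).Connected := by
  refine (connected_iff_exists_forall_reachable _).2 ⟨⟨b₁, h.mem_crossing₁.1⟩, fun v => ?_⟩
  let X : Set V := {w | ∃ hw : w ∈ S, (G.induce S).Reachable v ⟨w, hw⟩}
  obtain ⟨_, hr⟩ : b₁ ∈ X := h.b₁_mem_of_forall_adj hG (fun w hw => hw.1) ⟨v, v.2, .rfl⟩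
    fun u ⟨hu, hr⟩ w hw huw => ⟨hw, hr.trans (Adj.reachable (by simpa using huw))⟩
  exact hr.symm

lemma deleteEdges_adj_iff (h : IsTwoCut G S a₁ b₁ a₂ b₂) {u v : V} :
    (G.deleteEdges {s(a₁, b₁), s(a₂, b₂)}).Adj u v ↔ G.Adj u v ∧ (u ∈ S ↔ v ∈ S) := by
  have ha₁ := h.mem_crossing₁.2.1
  have ha₂ := h.mem_crossing₂.2.1
  have hb₁ := h.mem_crossing₁.1
  have hb₂ := h.mem_crossing₂.1
  rw [deleteEdges_adj]
  refine and_congr_right fun huv => ⟨fun hn => ?_, ?_⟩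
  · contrapose! hn
    rcases hn with ⟨hu, hv⟩ | ⟨hu, hv⟩
    · rcases h.eq_or_eq_of_adj hu hv huv with ⟨rfl, rfl⟩ | ⟨rfl, rfl⟩ <;> simp [Sym2.eq_swap]
    · rcases h.eq_or_eq_of_adj hv hu huv.symm with ⟨rfl, rfl⟩ | ⟨rfl, rfl⟩ <;> simp
  · rintro hS (he | he) <;> rcases Sym2.eq_iff.1 he with ⟨rfl, rfl⟩ | ⟨rfl, rfl⟩ <;> tauto

lemma reachable_deleteEdges_iff (h : IsTwoCut G S a₁ b₁ a₂ b₂) (hG : G.IsEdgeConnected 2) {u v : V}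
    (hu : u ∈ S) : (G.deleteEdges {s(a₁, b₁), s(a₂, b₂)}).Reachable u v ↔ v ∈ S := by
  constructor
  · intro hr
    by_contra hv
    obtain ⟨p, hp, hp', hadj⟩ := exists_mem_crossing_compl hr hu hv
    exact hp' ((h.deleteEdges_adj_iff.1 hadj).2.1 hp)
  · intro hv
    refine reachable_map_of_adj Subtype.val (fun x y hxy => Adj.reachable ?_)
      ((h.connected_induce hG).preconnected ⟨u, hu⟩ ⟨v, hv⟩)
    exact h.deleteEdges_adj_iff.2 ⟨hxy, by simp⟩

lemma isBibridge (h : IsTwoCut G S a₁ b₁ a₂ b₂) (hG : G.IsEdgeConnected 2) :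
    IsBibridge G s(a₁, b₁) s(a₂, b₂) where
  left_mem := h.mem_crossing₁.2.2.symm
  right_mem := h.mem_crossing₂.2.2.symm
  ne := h.edge_ne
  disconnects hc := h.mem_crossing₁.2.1
    ((h.reachable_deleteEdges_iff hG h.mem_crossing₁.1).1 (hc.preconnected _ _))

lemma isPart (h : IsTwoCut G S a₁ b₁ a₂ b₂) (hG : G.IsEdgeConnected 2) :
    IsPart G s(a₁, b₁) s(a₂, b₂) S := by
  refine ⟨connectedComponentMk _ b₁, ?_⟩
  ext v
  rw [ConnectedComponent.mem_supp_iff, ConnectedComponent.eq, reachable_comm,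
    h.reachable_deleteEdges_iff hG h.mem_crossing₁.1]

end IsTwoCut

lemma IsPart.eq_or_eq_of_mem_crossing {e f : Sym2 V} (h : IsPart G e f S) {p : V × V}
    (hp : p ∈ crossing G S Sᶜ) : s(p.1, p.2) = e ∨ s(p.1, p.2) = f := by
  obtain ⟨c, rfl⟩ := h
  by_contra hn
  exact hp.2.1 (c.mem_supp_of_adj_mem_supp hp.1 (deleteEdges_adj.2 ⟨hp.2.2, hn⟩))

lemma IsPart.nonempty_compl {e f : Sym2 V} (h : IsPart G e f S) (hef : IsBibridge G e f) :
    Sᶜ.Nonempty := by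
  obtain ⟨c, rfl⟩ := h
  by_contra! hall
  rw [Set.compl_empty_iff, Set.eq_univ_iff_forall] at hall
  obtain ⟨u, -⟩ := c.nonempty_supp
  refine hef.disconnects ((connected_iff_exists_forall_reachable _).2 ⟨u, fun v => ?_⟩)
  exact ConnectedComponent.exact ((hall u).trans (hall v).symm)

lemma IsPart.exists_isTwoCut (hG : G.IsEdgeConnected 2) {e f : Sym2 V} (hef : IsBibridge G e f)
    (h : IsPart G e f S) :
    ∃ a₁ b₁ a₂ b₂, s(a₁, b₁) = e ∧ s(a₂, b₂) = f ∧ IsTwoCut G S a₁ b₁ a₂ b₂ := by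
  have hS : S.Nonempty := by
    obtain ⟨c, rfl⟩ := h
    exact c.nonempty_supp
  have heq : ∀ {p q : V × V}, p ∈ crossing G S Sᶜ → q ∈ crossing G S Sᶜ →
      s(p.1, p.2) = s(q.1, q.2) → p = q := by
    rintro ⟨u, v⟩ ⟨x, y⟩ hp hq hpq
    rcases Sym2.eq_iff.1 hpq with ⟨rfl, rfl⟩ | ⟨rfl, rfl⟩
    exacts [rfl, (hp.2.1 hq.1).elim]
  have hnt := crossing_compl_nontrivial hG hS (h.nonempty_compl hef)
  have hex : ∀ g, ∃ p ∈ crossing G S Sᶜ, s(p.1, p.2) ≠ g := fun g => by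
    by_contra! hg
    obtain ⟨p, hp, q, hq, hpq⟩ := hnt
    exact hpq (heq hp hq ((hg p hp).trans (hg q hq).symm))
  obtain ⟨p, hp, hpf⟩ := hex f
  obtain ⟨q, hq, hqe⟩ := hex e
  have hpe : s(p.1, p.2) = e := (h.eq_or_eq_of_mem_crossing hp).resolve_right hpf
  have hqf : s(q.1, q.2) = f := (h.eq_or_eq_of_mem_crossing hq).resolve_left hqe
  refine ⟨p.2, p.1, q.2, q.1, Sym2.eq_swap.trans hpe, Sym2.eq_swap.trans hqf, ?_, ?_⟩
  · refine subset_antisymm (fun r hr => ?_) (Set.pair_subset hp hq)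
    exact (h.eq_or_eq_of_mem_crossing hr).imp (fun he => heq hr hp (he.trans hpe.symm))
      fun hf => heq hr hq (hf.trans hqf.symm)
  · exact fun hpq : p = q => hqe (hpq ▸ hpe)

end TwoCuts

section Split

variable {V : Type*} {G : SimpleGraph V}

lemma Split.isTwoCut (s : Split G) : IsTwoCut G s.side s.a₁ s.b₁ s.a₂ s.b₂ where
  crossing_eq := by
    refine subset_antisymm ?_ (Set.pair_subset ⟨s.b₁_mem, s.a₁_notMem, s.bibridge.left_mem.symm⟩
      ⟨s.b₂_mem, s.a₂_notMem, s.bibridge.right_mem.symm⟩)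
    rintro ⟨u, v⟩ hp
    have ha₁ := s.a₁_notMem
    have ha₂ := s.a₂_notMem
    rcases s.isPart.eq_or_eq_of_mem_crossing hp with h | h <;>
      rcases Sym2.eq_iff.1 h with ⟨rfl, rfl⟩ | ⟨rfl, rfl⟩
    exacts [(ha₁ hp.1).elim, .inl rfl, (ha₂ hp.1).elim, .inr rfl]
  ne h := s.bibridge.ne (by rw [(Prod.mk.inj h).1, (Prod.mk.inj h).2])

lemma imbalance_compl (S : Set V) : imbalance Sᶜ = imbalance S := by
  unfold imbalance
  rw [compl_compl]
  omega

lemma IsBiconnected.exists_isBibridge (hG : IsBiconnected G) : ∃ e f, IsBibridge G e f := by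
  obtain ⟨e, he, f, hf, hbr⟩ := hG.exists_edge
  rw [edgeSet_deleteEdges] at hf
  refine ⟨e, f, he, hf.1, fun h => hf.2 h.symm, fun hcon => ?_⟩
  induction f with | h u v
  rw [isBridge_iff, deleteEdges_deleteEdges] at hbr
  exact hbr (hcon.preconnected u v)

lemma IsBiconnected.exists_most_even (hG : IsBiconnected G) : ∃ (e f : Sym2 V) (S : Set V),
    IsBibridge G e f ∧ IsPart G e f S ∧
      ∀ e' f' S', IsBibridge G e' f' → IsPart G e' f' S' → imbalance S ≤ imbalance S' := by
  obtain ⟨e, f, hef⟩ := hG.exists_isBibridge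
  obtain ⟨v⟩ := hG.connected.nonempty
  obtain ⟨S, ⟨e, f, hef, hS⟩, hmin⟩ := exists_minimalFor_of_wellFoundedLT
    (fun S => ∃ e f, IsBibridge G e f ∧ IsPart G e f S) imbalance
    ⟨_, e, f, hef, connectedComponentMk _ v, rfl⟩
  exact ⟨e, f, S, hef, hS, fun e' f' S' hef' hS' =>
    (le_total _ _).elim id (hmin ⟨e', f', hef', hS'⟩)⟩

lemma IsBiconnected.nonempty_split (hG : IsBiconnected G) : Nonempty (Split G) := by
  have hG' := hG.isEdgeConnected_two
  obtain ⟨e, f, S, hef, hS, hmin⟩ := hG.exists_most_even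
  obtain ⟨a₁, b₁, a₂, b₂, rfl, rfl, h⟩ := hS.exists_isTwoCut hG' hef
  have mk : ∀ {T : Set V} {a₁ b₁ a₂ b₂ : V}, IsTwoCut G T a₁ b₁ a₂ b₂ → imbalance T = imbalance S →
      numDistinctCycleEdges (G.induce Tᶜ) ≤ numDistinctCycleEdges (G.induce T) →
      Nonempty (Split G) := fun {T a₁ b₁ a₂ b₂} h hT hle =>
    ⟨⟨a₁, b₁, a₂, b₂, h.isBibridge hG', T, h.isPart hG', h.mem_crossing₁.2.1, h.mem_crossing₁.1,
      h.mem_crossing₂.2.1, h.mem_crossing₂.1, hT ▸ hmin, hle⟩⟩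
  rcases le_total (numDistinctCycleEdges (G.induce Sᶜ)) (numDistinctCycleEdges (G.induce S))
    with hle | hle
  · exact mk h rfl hle
  · exact mk h.compl (imbalance_compl S) (by rwa [compl_compl])

end Split

section Growth

variable {V W : Type*} {H : SimpleGraph W} {H' : SimpleGraph V}

lemma similar_refl (e : Sym2 W) : Similar H e e := ⟨Iso.refl, by simp [Iso.refl]⟩

lemma Similar.symm {e f : Sym2 W} (h : Similar H e f) : Similar H f e := by
  obtain ⟨φ, rfl⟩ := h
  refine ⟨φ.symm, ?_⟩
  have hφ : φ.symm ∘ φ = id := funext φ.symm_apply_apply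
  rw [Sym2.map_map, hφ, Sym2.map_id, id]

lemma Similar.trans {e f g : Sym2 W} (h : Similar H e f) (h' : Similar H f g) :
    Similar H e g := by
  obtain ⟨φ, rfl⟩ := h
  obtain ⟨ψ, rfl⟩ := h'
  exact ⟨φ.trans ψ, by rw [Sym2.map_map]; rfl⟩

lemma setOf_similar_eq_iff {e f : Sym2 W} :
    {g | Similar H e g} = {g | Similar H f g} ↔ Similar H e f := by
  constructor
  · intro h
    have : f ∈ {g | Similar H e g} := h ▸ similar_refl f
    exact this
  · intro h
    ext g
    exact ⟨h.symm.trans, h.trans⟩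

lemma cycleEdges_subset_edgeSet : cycleEdges H ⊆ H.edgeSet := by
  rintro e ⟨u, p, -, he⟩
  exact p.edges_subset_edgeSet he

lemma mem_cycleEdges_iff {u v : W} (huv : H.Adj u v) :
    s(u, v) ∈ cycleEdges H ↔ (H.deleteEdges {s(u, v)}).Reachable u v := by
  have h := isBridge_iff_forall_cycle_notMem ((mem_edgeSet H).2 huv)
  rw [isBridge_iff, ← not_iff_not, not_not] at h
  rw [h]
  push Not
  rfl

lemma le_numDistinctCycleEdges_of_injective [Finite W] {M : ℕ} (e : Fin M → Sym2 W)
    (he : ∀ k, e k ∈ cycleEdges H) (hinj : ∀ k l, Similar H (e k) (e l) → k = l) :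
    M ≤ numDistinctCycleEdges H := by
  have hinj' : Function.Injective fun k => {f | Similar H (e k) f} := fun k l hkl =>
    hinj k l (setOf_similar_eq_iff.1 hkl)
  rw [← Nat.card_fin M, ← Set.ncard_univ, ← Set.ncard_image_of_injective _ hinj', Set.image_univ]
  refine Set.ncard_le_ncard ?_ (Set.toFinite _)
  rintro _ ⟨k, rfl⟩
  exact ⟨e k, he k, rfl⟩

lemma numDistinctCycleEdges_le [Finite W] : numDistinctCycleEdges H ≤ Nat.card W ^ 2 := by
  calc numDistinctCycleEdges H ≤ (cycleEdges H).ncard := Set.ncard_image_le (Set.toFinite _)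
    _ ≤ Nat.card (Sym2 W) := Set.ncard_le_card _
    _ ≤ Nat.card (W × W) := Nat.card_le_card_of_surjective _ Quot.mk_surjective
    _ = Nat.card W ^ 2 := by rw [Nat.card_prod, sq]

/-- The vertices at distance at most `k` from the set `T`. -/
def setBall (H : SimpleGraph W) (T : Set W) : ℕ → Set W
  | 0 => T
  | k + 1 => setBall H T k ∪ {v | ∃ u ∈ setBall H T k, H.Adj u v}

lemma setBall_mono (T : Set W) : Monotone (setBall H T) :=
  monotone_nat_of_le_succ fun _ => Set.subset_union_left

lemma mem_setBall_succ_of_adj {T : Set W} {k : ℕ} {u v : W} (hu : u ∈ setBall H T k)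
    (h : H.Adj u v) : v ∈ setBall H T (k + 1) :=
  .inr ⟨u, hu, h⟩

lemma mapsTo_setBall (φ : H →g H') {T : Set W} {T' : Set V} (h : Set.MapsTo φ T T') (k : ℕ) :
    Set.MapsTo φ (setBall H T k) (setBall H' T' k) := by
  induction k with
  | zero => exact h
  | succ k ih =>
    rintro v (hv | ⟨u, hu, huv⟩)
    · exact .inl (ih hv)
    · exact mem_setBall_succ_of_adj (ih hu) (φ.map_adj huv)

lemma ncard_setBall_le [Finite W] {D : ℕ} (hD : ∀ v, (H.neighborSet v).ncard ≤ D) (T : Set W)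
    (k : ℕ) : (setBall H T k).ncard ≤ T.ncard * (D + 1) ^ k := by
  classical
  have := Fintype.ofFinite W
  induction k with
  | zero => simp [setBall]
  | succ k ih =>
    have hsub : setBall H T (k + 1) ⊆
        ↑((setBall H T k).toFinset.biUnion fun u => insert u (H.neighborSet u).toFinset) := by
      rintro v (hv | ⟨u, hu, huv⟩)
      · simpa using ⟨v, hv, .inl rfl⟩
      · simpa using ⟨u, hu, .inr huv⟩
    calc (setBall H T (k + 1)).ncard
        ≤ (setBall H T k).ncard * (D + 1) := by
          refine (Set.ncard_le_ncard hsub).trans ?_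
          rw [Set.ncard_coe_finset, Set.ncard_eq_toFinset_card' (setBall H T k)]
          refine Finset.card_biUnion_le_card_mul _ _ _ fun u _ => ?_
          refine (Finset.card_insert_le _ _).trans (Nat.add_le_add_right ?_ 1)
          rw [← Set.ncard_eq_toFinset_card']
          exact hD u
      _ ≤ T.ncard * (D + 1) ^ (k + 1) := by
          rw [pow_succ, ← mul_assoc]
          exact Nat.mul_le_mul_right _ ih

lemma setOf_subset_setBall_eq_Ici {T : Set W} {k : ℕ} {u v : W} (huv : H.Adj u v)
    (hu : u ∈ setBall H T k) (hv : v ∉ setBall H T k) :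
    {j | ∀ w ∈ s(u, v), w ∈ setBall H T j} = Set.Ici (k + 1) := by
  ext j
  simp only [Sym2.mem_iff, forall_eq_or_imp, forall_eq, Set.mem_ofPred_eq, Set.mem_Ici,
    Nat.add_one_le_iff]
  constructor
  · rintro ⟨-, hvj⟩
    by_contra! hj
    exact hv (setBall_mono T hj hvj)
  · intro hj
    exact ⟨setBall_mono T hj.le hu, setBall_mono T hj (mem_setBall_succ_of_adj hu huv)⟩

lemma Similar.setOf_subset_setBall_subset {e f : Sym2 W} (h : Similar H e f) {T : Set W}
    (hT : ∀ φ : H ≃g H, Set.MapsTo φ T T) :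
    {j | ∀ w ∈ e, w ∈ setBall H T j} ⊆ {j | ∀ w ∈ f, w ∈ setBall H T j} := by
  obtain ⟨φ, rfl⟩ := h
  intro j hj w hw
  obtain ⟨v, hv, rfl⟩ := Sym2.mem_map.1 hw
  exact mapsTo_setBall φ.toHom (hT φ) j (hj v hv)

/-- Edges leaving the balls of different radii around an invariant set are distinct. -/
lemma le_numDistinctCycleEdges [Finite W] (hc : H.Preconnected) {D : ℕ}
    (hD : ∀ v, (H.neighborSet v).ncard ≤ D) {T : Set W} (hT : T.Nonempty)
    (hinv : ∀ φ : H ≃g H, Set.MapsTo φ T T)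
    (hcyc : ∀ u ∉ T, ∀ v ∉ T, H.Adj u v → s(u, v) ∈ cycleEdges H) {M : ℕ}
    (hM : T.ncard * (D + 1) ^ M < Nat.card W) : M ≤ numDistinctCycleEdges H := by
  have hex : ∀ k : Fin M, ∃ p, p ∈ crossing H (setBall H T (k + 1)) (setBall H T (k + 1))ᶜ := by
    intro k
    obtain ⟨t, ht⟩ := hT
    obtain ⟨w, hw⟩ : ∃ w, w ∉ setBall H T (k + 1) := by
      by_contra! hall
      have hball := ncard_setBall_le hD T (k + 1)
      rw [Set.eq_univ_of_forall hall, Set.ncard_univ] at hball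
      have : T.ncard * (D + 1) ^ ((k : ℕ) + 1) ≤ T.ncard * (D + 1) ^ M :=
        Nat.mul_le_mul_left _ (Nat.pow_le_pow_right D.succ_pos k.2)
      omega
    exact exists_mem_crossing_compl (hc t w) (setBall_mono T (Nat.zero_le _) ht) hw
  choose p hu hv huv using hex
  refine le_numDistinctCycleEdges_of_injective (fun k => s((p k).1, (p k).2)) (fun k => ?_)
    fun k l hkl => ?_
  · have hu' : (p k).1 ∉ T := fun h => hv k <|
      setBall_mono T (Nat.le_add_left 1 k) (mem_setBall_succ_of_adj (k := 0) h (huv k))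
    exact hcyc _ hu' _ (fun h => hv k (setBall_mono T (Nat.zero_le _) h)) (huv k)
  · have hrad : Set.Ici ((k : ℕ) + 1 + 1) = Set.Ici ((l : ℕ) + 1 + 1) := by
      rw [← setOf_subset_setBall_eq_Ici (huv k) (hu k) (hv k),
        ← setOf_subset_setBall_eq_Ici (huv l) (hu l) (hv l)]
      exact (hkl.setOf_subset_setBall_subset hinv).antisymm
        (hkl.symm.setOf_subset_setBall_subset hinv)
    exact Fin.ext (by simpa using Set.Ici_injective hrad)

lemma ncard_neighborSet_iso (φ : H ≃g H') (v : W) :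
    (H'.neighborSet (φ v)).ncard = (H.neighborSet v).ncard :=
  (Nat.card_congr (φ.mapNeighborSet v)).symm

lemma le_numDistinctCycleEdges_of_ncard_neighborSet_le [Finite W] (hc : H.Preconnected) {D : ℕ}
    (hD : ∀ v, (H.neighborSet v).ncard ≤ D) (hne : ∃ v, (H.neighborSet v).ncard ≠ D)
    (hcyc : ∀ u v, (H.neighborSet u).ncard = D → (H.neighborSet v).ncard = D → H.Adj u v →
      s(u, v) ∈ cycleEdges H) {M : ℕ}
    (hM : {v | (H.neighborSet v).ncard ≠ D}.ncard * (D + 1) ^ M < Nat.card W) :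
    M ≤ numDistinctCycleEdges H := by
  refine le_numDistinctCycleEdges (T := {v | (H.neighborSet v).ncard ≠ D}) hc hD hne
    (fun φ v hv => ?_) (fun u hu v hv => ?_) hM
  · rwa [Set.mem_ofPred_eq, ncard_neighborSet_iso]
  · exact hcyc u v (not_not.1 hu) (not_not.1 hv)

end Growth

section Reattachment

variable {V V' K : Type*} {G : SimpleGraph V} {G' : SimpleGraph V'} {T : SimpleGraph K}
  {R : Set (V × V × K)} {R' : Set (V' × V' × K)}

/-- A set of edges of `G` whose two ends are to be moved to new vertices from `K`: `(v, w, k) ∈ R`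
means that `v` trades its neighbour `w` for `k`. Distinct neighbours of `v` are traded for
distinct new vertices, so that no edge is doubled. -/
structure IsReattachment (G : SimpleGraph V) (R : Set (V × V × K)) : Prop where
  adj : ∀ {v w k}, (v, w, k) ∈ R → G.Adj v w
  exists_symm : ∀ {v w k}, (v, w, k) ∈ R → ∃ l, (w, v, l) ∈ R
  right_unique : ∀ {v w k l}, (v, w, k) ∈ R → (v, w, l) ∈ R → k = l
  left_unique : ∀ {v w x k}, (v, w, k) ∈ R → (v, x, k) ∈ R → w = x

/-- The graph obtained from `G` by carrying out the trades in `R`, where the new vertices are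
joined among themselves as in `T`. -/
def reattach (G : SimpleGraph V) (T : SimpleGraph K) (R : Set (V × V × K)) :
    SimpleGraph (V ⊕ K) where
  Adj
    | .inl v, .inl w => G.Adj v w ∧ ∀ k, (v, w, k) ∉ R ∧ (w, v, k) ∉ R
    | .inl v, .inr k => ∃ w, (v, w, k) ∈ R
    | .inr k, .inl v => ∃ w, (v, w, k) ∈ R
    | .inr k, .inr l => T.Adj k l
  symm := ⟨by
    rintro (v | k) (w | l) h
    exacts [⟨h.1.symm, fun k => (h.2 k).symm⟩, h, h, T.adj_symm h]⟩
  loopless := ⟨by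
    rintro (v | k) h
    exacts [G.irrefl h.1, T.irrefl h]⟩

@[simp] lemma reattach_adj_inl_inl {v w : V} : (reattach G T R).Adj (.inl v) (.inl w) ↔
    G.Adj v w ∧ ∀ k, (v, w, k) ∉ R ∧ (w, v, k) ∉ R := Iff.rfl

@[simp] lemma reattach_adj_inl_inr {v : V} {k : K} :
    (reattach G T R).Adj (.inl v) (.inr k) ↔ ∃ w, (v, w, k) ∈ R := Iff.rfl

@[simp] lemma reattach_adj_inr_inl {v : V} {k : K} :
    (reattach G T R).Adj (.inr k) (.inl v) ↔ ∃ w, (v, w, k) ∈ R := Iff.rfl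

@[simp] lemma reattach_adj_inr_inr {k l : K} :
    (reattach G T R).Adj (.inr k) (.inr l) ↔ T.Adj k l := Iff.rfl

lemma ncard_neighborSet_reattach_inr [Finite V] [Finite K] (k : K) :
    ((reattach G T R).neighborSet (.inr k)).ncard =
      {v | ∃ w, (v, w, k) ∈ R}.ncard + (T.neighborSet k).ncard := by
  rw [← Set.ncard_image_of_injective {v | ∃ w, (v, w, k) ∈ R} (Sum.inl_injective (β := K)),
    ← Set.ncard_image_of_injective (T.neighborSet k) (Sum.inr_injective (α := V)),
    ← Set.ncard_union_eq Set.disjoint_image_inl_image_inr]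
  congr 1
  ext (v | l) <;> simp

namespace IsReattachment

lemma exists_or_reattach_adj (T : SimpleGraph K) (hR : IsReattachment G R) {v w : V}
    (h : G.Adj v w) :
    (∃ k l, (v, w, k) ∈ R ∧ (w, v, l) ∈ R) ∨ (reattach G T R).Adj (.inl v) (.inl w) := by
  by_cases h' : ∃ k, (v, w, k) ∈ R ∨ (w, v, k) ∈ R
  · obtain ⟨k, hk | hk⟩ := h'
    · obtain ⟨l, hl⟩ := hR.exists_symm hk
      exact .inl ⟨k, l, hk, hl⟩
    · obtain ⟨l, hl⟩ := hR.exists_symm hk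
      exact .inl ⟨l, k, hl, hk⟩
  · push Not at h'
    exact .inr ⟨h, h'⟩

lemma exists_injective_newEnd (hR : IsReattachment G R) (v : V) :
    ∃ f : V → V ⊕ K, Function.Injective f ∧ (∀ w k, (v, w, k) ∈ R → f w = .inr k) ∧
      ∀ w, (∀ k, (v, w, k) ∉ R) → f w = .inl w := by
  classical
  let f : V → V ⊕ K := fun w => if h : ∃ k, (v, w, k) ∈ R then .inr h.choose else .inl w
  have hf : ∀ w k, (v, w, k) ∈ R → f w = .inr k := fun w k h => by
    have hex : ∃ k, (v, w, k) ∈ R := ⟨k, h⟩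
    simp only [f, dif_pos hex, hR.right_unique hex.choose_spec h]
  have hf' : ∀ w, (∀ k, (v, w, k) ∉ R) → f w = .inl w := fun w h => dif_neg (by simpa using h)
  refine ⟨f, fun w x hwx => ?_, hf, hf'⟩
  by_cases hw : ∃ k, (v, w, k) ∈ R <;> by_cases hx : ∃ k, (v, x, k) ∈ R
  · obtain ⟨k, hw⟩ := hw
    obtain ⟨l, hx⟩ := hx
    rw [hf w k hw, hf x l hx, Sum.inr.injEq] at hwx
    exact hR.left_unique hw (hwx ▸ hx)
  · rw [hf w _ hw.choose_spec, hf' x (by simpa using hx)] at hwx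
    cases hwx
  · rw [hf x _ hx.choose_spec, hf' w (by simpa using hw)] at hwx
    cases hwx
  · rw [hf' w (by simpa using hw), hf' x (by simpa using hx)] at hwx
    exact Sum.inl_injective hwx

lemma ncard_neighborSet_inl (hR : IsReattachment G R) (v : V) :
    ((reattach G T R).neighborSet (.inl v)).ncard = (G.neighborSet v).ncard := by
  obtain ⟨f, hinj, hf, hf'⟩ := hR.exists_injective_newEnd v
  rw [← Set.ncard_image_of_injective _ hinj]
  congr 1
  ext (w | k)
  · constructor
    · exact fun h => ⟨w, h.1, hf' w fun k => (h.2 k).1⟩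
    · rintro ⟨x, hx, hfx⟩
      rcases hR.exists_or_reattach_adj T hx with ⟨k, -, hk, -⟩ | h
      · cases (hf x k hk).symm.trans hfx
      · cases (hf' x fun k => (h.2 k).1).symm.trans hfx
        exact h
  · constructor
    · rintro ⟨w, hw⟩
      exact ⟨w, hR.adj hw, hf w k hw⟩
    · rintro ⟨x, hx, hfx⟩
      rcases hR.exists_or_reattach_adj T hx with ⟨l, -, hl, -⟩ | h
      · cases (hf x l hl).symm.trans hfx
        exact ⟨x, hl⟩
      · cases (hf' x fun k => (h.2 k).1).symm.trans hfx

lemma reachable_inl (hR : IsReattachment G R) (hT : T.Preconnected) {L : SimpleGraph (V ⊕ K)}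
    (hL : ∀ k p, (reattach G T R).Adj (.inr k) p → L.Adj (.inr k) p) {v w : V} (h : G.Adj v w)
    (hvw : (reattach G T R).Adj (.inl v) (.inl w) → L.Adj (.inl v) (.inl w)) :
    L.Reachable (.inl v) (.inl w) := by
  rcases hR.exists_or_reattach_adj T h with ⟨k, l, hk, hl⟩ | h
  · have hkl : L.Reachable (.inr k) (.inr l) :=
      reachable_map_of_adj Sum.inr (fun i j hij => (hL i (.inr j) hij).reachable) (hT k l)
    have hkv : L.Adj (.inr k) (.inl v) := hL _ _ ⟨w, hk⟩
    have hlw : L.Adj (.inr l) (.inl w) := hL _ _ ⟨v, hl⟩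
    exact (hkv.symm.reachable.trans hkl).trans hlw.reachable
  · exact (hvw h).reachable

lemma connected (hR : IsReattachment G R) (hG : G.Connected) (hT : T.Preconnected)
    (hne : R.Nonempty) : (reattach G T R).Connected := by
  obtain ⟨⟨v, w, k⟩, h⟩ := hne
  refine (connected_iff_exists_forall_reachable _).2 ⟨.inl v, ?_⟩
  rintro (x | l)
  · exact reachable_map_of_adj Sum.inl (fun _ _ hxy => hR.reachable_inl hT (fun _ _ => id) hxy id)
      (hG v x)
  · have hvk : (reattach G T R).Adj (.inl v) (.inr k) := ⟨w, h⟩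
    exact hvk.reachable.trans (reachable_map_of_adj Sum.inr
      (fun i j hij => Adj.reachable (reattach_adj_inr_inr.2 hij)) (hT k l))

lemma mem_cycleEdges (hR : IsReattachment G R) (hG : G.IsEdgeConnected 2) (hT : T.Preconnected)
    {v w : V} (h : (reattach G T R).Adj (.inl v) (.inl w)) :
    s(.inl v, .inl w) ∈ cycleEdges (reattach G T R) := by
  rw [mem_cycleEdges_iff h]
  refine reachable_map_of_adj Sum.inl (fun x y hxy => ?_) (isEdgeConnected_two.1 hG s(v, w) v w)
  rw [deleteEdges_adj] at hxy
  refine hR.reachable_inl hT (fun k p hkp => deleteEdges_adj.2 ⟨hkp, ?_⟩) hxy.1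
    fun h' => deleteEdges_adj.2 ⟨h', ?_⟩
  · simp
  · simpa using hxy.2

lemma adj_iff_of_iso {T' : SimpleGraph K} (hR : IsReattachment G R) (hR' : IsReattachment G' R')
    (ψ : reattach G T R ≃g reattach G' T' R') {σ : V → V'} (hσ : ∀ v, ψ (.inl v) = .inl (σ v))
    (hRR' : ∀ v w k, (v, w, k) ∈ R ↔ (σ v, σ w, k) ∈ R') (v w : V) :
    G'.Adj (σ v) (σ w) ↔ G.Adj v w := by
  constructor <;> intro h
  · rcases hR'.exists_or_reattach_adj T' h with ⟨k, -, hk, -⟩ | h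
    · exact hR.adj ((hRR' _ _ _).2 hk)
    · rw [← hσ, ← hσ, ψ.map_adj_iff] at h
      exact h.1
  · rcases hR.exists_or_reattach_adj T h with ⟨k, -, hk, -⟩ | h
    · exact hR'.adj ((hRR' _ _ _).1 hk)
    · rw [← ψ.map_adj_iff, hσ, hσ] at h
      exact h.1

end IsReattachment

lemma exists_equiv_inl_of_inr (ψ : V ⊕ K ≃ V' ⊕ K) (h : ∀ k, ψ (.inr k) = .inr k) :
    ∃ σ : V ≃ V', ∀ v, ψ (.inl v) = .inl (σ v) := by
  have hleft : ∀ p, p.isLeft ↔ (ψ p).isLeft := by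
    rintro (v | k)
    · simp only [Sum.isLeft_inl, true_iff]
      rcases hv : ψ (.inl v) with w | k
      · rfl
      · cases ψ.injective (hv.trans (h k).symm)
    · rw [h]
      simp only [Sum.isLeft_inr]
  exact ⟨Equiv.sumIsLeft.symm.trans ((ψ.subtypeEquiv hleft).trans Equiv.sumIsLeft),
    fun v => (Sum.inl_getLeft _ _).symm⟩

/-- The trades in `R`, and those that move the end `x` of the edge `xy` to `k` and the end `y` to
`l`. -/
def trade (R : Set (V × V × K)) (x y : V) (k l : K) : Set (V × V × K) :=
  insert (x, y, k) (insert (y, x, l) R)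

lemma mem_trade {x y v w : V} {k l j : K} : (v, w, j) ∈ trade R x y k l ↔
    v = x ∧ w = y ∧ j = k ∨ v = y ∧ w = x ∧ j = l ∨ (v, w, j) ∈ R := by
  simp [trade]

lemma isReattachment_empty : IsReattachment G (∅ : Set (V × V × K)) where
  adj h := h.elim
  exists_symm h := h.elim
  right_unique h := h.elim
  left_unique h := h.elim

lemma IsReattachment.trade (hR : IsReattachment G R) {x y : V} {k l : K} (hxy : G.Adj x y)
    (hxyR : ∀ j, (x, y, j) ∉ R) (hk : ∀ w, (x, w, k) ∉ R) (hl : ∀ w, (y, w, l) ∉ R) :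
    IsReattachment G (trade R x y k l) := by
  have hyxR : ∀ j, (y, x, j) ∉ R := fun j h => (hR.exists_symm h).elim hxyR
  have hne := hxy.ne
  constructor
  · intro v w j h
    rcases mem_trade.1 h with ⟨rfl, rfl, -⟩ | ⟨rfl, rfl, -⟩ | h
    exacts [hxy, hxy.symm, hR.adj h]
  · intro v w j h
    rcases mem_trade.1 h with ⟨rfl, rfl, -⟩ | ⟨rfl, rfl, -⟩ | h
    · exact ⟨l, mem_trade.2 (by simp)⟩
    · exact ⟨k, mem_trade.2 (by simp)⟩
    · obtain ⟨i, hi⟩ := hR.exists_symm h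
      exact ⟨i, mem_trade.2 (.inr (.inr hi))⟩
  · intro v w i j h h'
    have := @hR.right_unique v w i j
    rw [mem_trade] at h h'
    grind
  · intro v w u j h h'
    have := @hR.left_unique v w u j
    rw [mem_trade] at h h'
    grind

lemma reattach_trade (x y : V) (k l : K) : reattach G T (trade R x y k l) =
    (reattach G T R).deleteEdges {s(.inl x, .inl y)} ⊔
      fromEdgeSet {s(.inl x, .inr k), s(.inl y, .inr l)} := by
  ext (v | i) (w | j) <;>
    simp only [sup_adj, deleteEdges_adj, fromEdgeSet_adj, reattach_adj_inl_inl,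
      reattach_adj_inl_inr, reattach_adj_inr_inl, reattach_adj_inr_inr, mem_trade,
      Set.mem_insert_iff, Set.mem_singleton_iff, Sym2.eq_iff] <;>
    grind

end Reattachment

section Induce

variable {W : Type*} {H : SimpleGraph W} {X : Set W}

/-- Retract `H` to `X` by sending everything outside of `X` to `x`. -/
lemma reachable_induce_of_crossing {x : X} (hX : ∀ p ∈ crossing H X Xᶜ, p.1 = x) {u v : X}
    (h : H.Reachable u v) : (H.induce X).Reachable u v := by
  classical
  let f : W → X := fun w => if hw : w ∈ X then ⟨w, hw⟩ else x
  have hf : ∀ w : X, f w = w := fun w => dif_pos w.2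
  have hf' : ∀ {w}, w ∉ X → f w = x := fun hw => dif_neg hw
  have hcross : ∀ {w w'}, w ∈ X → w' ∉ X → H.Adj w w' → f w = f w' := fun {w w'} hw hw' hww' => by
    rw [hf' hw', hf ⟨w, hw⟩]
    exact Subtype.ext (hX (w, w') ⟨hw, hw', hww'⟩)
  rw [← hf u, ← hf v]
  refine reachable_map_of_adj f (fun w w' hww' => ?_) h
  by_cases hw : w ∈ X <;> by_cases hw' : w' ∈ X
  · rw [hf ⟨w, hw⟩, hf ⟨w', hw'⟩]
    exact Adj.reachable hww'
  · rw [hcross hw hw' hww']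
  · rw [hcross hw' hw hww'.symm]
  · rw [hf' hw, hf' hw']

lemma mem_cycleEdges_induce_of_crossing {x : X} (hX : ∀ p ∈ crossing H X Xᶜ, p.1 = x) {u v : X}
    (huv : H.Adj u v) (h : s(u.1, v.1) ∈ cycleEdges H) : s(u, v) ∈ cycleEdges (H.induce X) := by
  rw [mem_cycleEdges_iff huv] at h
  rw [mem_cycleEdges_iff (by exact huv)]
  refine (reachable_induce_of_crossing (x := x) ?_ h).mono fun p q hpq => ?_
  · exact fun p hp => hX p ⟨hp.1, hp.2.1, (deleteEdges_adj.1 hp.2.2).1⟩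
  · rw [comap_adj, deleteEdges_adj] at hpq
    refine deleteEdges_adj.2 ⟨hpq.1, fun he => hpq.2 ?_⟩
    rw [Set.mem_singleton_iff] at he ⊢
    exact congrArg (Sym2.map Subtype.val) he

lemma ncard_neighborSet_induce (H : SimpleGraph W) (v : X) :
    ((H.induce X).neighborSet v).ncard = (H.neighborSet v ∩ X).ncard := by
  rw [← Set.ncard_image_of_injective _ Subtype.val_injective]
  congr 1
  ext w
  simp

end Induce

namespace Split

variable {V : Type*} {G : SimpleGraph V} (s : Split G)

@[simp] lemma inl_mem_extSide {v : V} : .inl v ∈ s.extSide ↔ v ∈ s.side := by simp [extSide]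

@[simp] lemma inr_mem_extSide {k : Fin 4} : .inr k ∈ s.extSide ↔ k ≠ 0 := by
  fin_cases k <;> simp [extSide]

/-- The trades that turn `G` into `G'`: the ends `a₁, a₂` of the bi-bridge are moved to `n₁` and
the ends `b₁` and `b₂` to `n₃` and `n₄`. -/
def trades : Set (V × V × Fin 4) :=
  trade (trade ∅ s.a₁ s.b₁ 0 2) s.a₂ s.b₂ 0 3

lemma mem_trades {v w : V} {k : Fin 4} : (v, w, k) ∈ s.trades ↔
    v = s.a₂ ∧ w = s.b₂ ∧ k = 0 ∨ v = s.b₂ ∧ w = s.a₂ ∧ k = 3 ∨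
      v = s.a₁ ∧ w = s.b₁ ∧ k = 0 ∨ v = s.b₁ ∧ w = s.a₁ ∧ k = 2 := by
  simp [trades, mem_trade]

lemma isReattachment_trades (hG : G.IsEdgeConnected 2) (h3 : IsCubic G) :
    IsReattachment G s.trades := by
  have ha := s.isTwoCut.a_ne hG h3
  refine (isReattachment_empty.trade s.bibridge.left_mem ?_ ?_ ?_).trade s.bibridge.right_mem
    ?_ ?_ ?_
  · simp
  · simp
  · simp
  · have := s.bibridge.ne
    intro j
    rw [mem_trade]
    grind
  · simp [mem_trade, ha.symm]
  · simp [mem_trade]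

/-- The edges between `n₁, n₂, n₃, n₄` form a star with centre `n₂`. -/
lemma splitGraph_eq : s.splitGraph = reattach G (starGraph 1) s.trades := by
  ext (v | i) (w | j)
  case inr.inr => fin_cases i <;> fin_cases j <;> simp [splitGraph]
  all_goals
    simp only [splitGraph, sup_adj, map_adj, deleteEdges_adj, fromEdgeSet_adj,
      reattach_adj_inl_inl, reattach_adj_inl_inr, reattach_adj_inr_inl, mem_trades,
      Function.Embedding.inl_apply, Sum.inl.injEq, Sum.inr.injEq, reduceCtorEq,
      Set.mem_insert_iff, Set.mem_singleton_iff, Sym2.eq, Sym2.rel_iff', Prod.mk.injEq,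
      Prod.swap_prod_mk, not_or, not_and, and_false, false_and, or_self, and_self, ne_eq,
      or_false, false_or, exists_eq_right_right, exists_eq_right, exists_false,
      not_false_eq_true, and_true, and_congr_right_iff]
    grind

lemma insertion_eq {d : s.extGraph.Dart} {x y : V} (hx : d.fst.1 = .inl x)
    (hy : d.snd.1 = .inl y) :
    s.insertion d = reattach G (starGraph 1) (trade s.trades x y 2 3) := by
  rw [reattach_trade, ← splitGraph_eq, insertion, hx, hy]

end Split

section Extension

variable {V : Type*} {G : SimpleGraph V} (s : Split G)

namespace Split

lemma connected_splitGraph (hG : G.IsEdgeConnected 2) (h3 : IsCubic G) :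
    s.splitGraph.Connected := by
  have : Nonempty V := ⟨s.a₁⟩
  rw [splitGraph_eq]
  exact (s.isReattachment_trades hG h3).connected (hG.connected two_ne_zero)
    (connected_starGraph 1).preconnected ⟨_, s.mem_trades.2 (.inl ⟨rfl, rfl, rfl⟩)⟩

lemma crossing_splitGraph : crossing s.splitGraph s.extSide s.extSideᶜ = {(.inr 1, .inr 0)} := by
  have ha₁ := s.a₁_notMem
  have ha₂ := s.a₂_notMem
  have hb₁ := s.b₁_mem
  have hb₂ := s.b₂_mem
  rw [splitGraph_eq]
  ext ⟨u | k, v | l⟩ <;>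
    simp only [mem_crossing, Set.mem_compl_iff, inl_mem_extSide, inr_mem_extSide,
      reattach_adj_inl_inl, reattach_adj_inl_inr, reattach_adj_inr_inl, reattach_adj_inr_inr,
      starGraph_adj, mem_trades, Set.mem_singleton_iff, Prod.mk.injEq, reduceCtorEq, false_and,
      and_false, iff_false, Sum.inr.injEq]
  · rintro ⟨hu, hv, huv, hR⟩
    have := s.isTwoCut.eq_or_eq_of_adj hu hv huv
    grind
  · grind
  · grind
  · grind

lemma eq_inr_one_of_mem_crossing (h : (.inr 1 : V ⊕ Fin 4) ∈ s.extSide) :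
    ∀ p ∈ crossing s.splitGraph s.extSide s.extSideᶜ, p.1 = (⟨_, h⟩ : s.extSide) := by
  simp [crossing_splitGraph]

lemma preconnected_extGraph (hG : G.IsEdgeConnected 2) (h3 : IsCubic G) :
    s.extGraph.Preconnected := fun _ _ =>
  reachable_induce_of_crossing (s.eq_inr_one_of_mem_crossing (by simp))
    ((s.connected_splitGraph hG h3).preconnected _ _)

lemma mem_cycleEdges_extGraph (hG : G.IsEdgeConnected 2) (h3 : IsCubic G) {v w : s.extSide}
    (h : s.extGraph.Adj v w) (hv : v.1.isLeft) (hw : w.1.isLeft) :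
    s(v, w) ∈ cycleEdges s.extGraph := by
  obtain ⟨x, hx⟩ := Sum.isLeft_iff.1 hv
  obtain ⟨y, hy⟩ := Sum.isLeft_iff.1 hw
  refine mem_cycleEdges_induce_of_crossing (s.eq_inr_one_of_mem_crossing (by simp)) h ?_
  have hadj : s.splitGraph.Adj v w := h
  rw [hx, hy, splitGraph_eq] at hadj ⊢
  exact (s.isReattachment_trades hG h3).mem_cycleEdges hG (connected_starGraph 1).preconnected hadj

lemma ncard_neighborSet_extGraph_inl (hG : G.IsEdgeConnected 2) (h3 : IsCubic G) {v : s.extSide}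
    (hv : v.1.isLeft) : (s.extGraph.neighborSet v).ncard = 3 := by
  obtain ⟨x, hx⟩ := Sum.isLeft_iff.1 hv
  have hsub : s.splitGraph.neighborSet v ⊆ s.extSide := fun w hw => by
    by_contra hw'
    have : (v.1, w) ∈ crossing s.splitGraph s.extSide s.extSideᶜ := ⟨v.2, hw', hw⟩
    simp [crossing_splitGraph, hx] at this
  rw [extGraph, ncard_neighborSet_induce, Set.inter_eq_left.2 hsub, hx, splitGraph_eq,
    (s.isReattachment_trades hG h3).ncard_neighborSet_inl, h3]

lemma ncard_neighborSet_extGraph_inr {v : s.extSide} (hv : v.1.isRight) :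
    (s.extGraph.neighborSet v).ncard = 2 := by
  have hb₁ := s.b₁_mem
  have hb₂ := s.b₂_mem
  obtain ⟨v, hv'⟩ := v
  obtain ⟨k, rfl⟩ := Sum.isRight_iff.1 hv
  rw [extGraph, ncard_neighborSet_induce, splitGraph_eq, Set.ncard_eq_two]
  have hk := s.inr_mem_extSide.1 hv'
  have : k = 1 ∨ k = 2 ∨ k = 3 := by omega
  rcases this with rfl | rfl | rfl
  on_goal 1 => refine ⟨.inr 2, .inr 3, by simp, ?_⟩
  on_goal 2 => refine ⟨.inl s.b₁, .inr 1, by simp, ?_⟩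
  on_goal 3 => refine ⟨.inl s.b₂, .inr 1, by simp, ?_⟩
  all_goals
    ext (v | l) <;>
      simp only [Set.mem_inter_iff, mem_neighborSet, reattach_adj_inr_inl, reattach_adj_inr_inr,
        starGraph_adj, mem_trades, inl_mem_extSide, inr_mem_extSide,
        Set.mem_insert_iff, Set.mem_singleton_iff, Sum.inl.injEq, Sum.inr.injEq, reduceCtorEq] <;>
      grind

end Split
end Extension

section Size

variable {V : Type*} {G : SimpleGraph V} [Finite V]

lemma IsTwoCut.le_numDistinctCycleEdges_induce {S : Set V} {a₁ b₁ a₂ b₂ : V}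
    (h : IsTwoCut G S a₁ b₁ a₂ b₂) (hG : G.IsEdgeConnected 2) (h3 : IsCubic G)
    (hS : ¬ HasBridge (G.induce S)) {M : ℕ} (hM : 2 * 4 ^ M < S.ncard) :
    M ≤ numDistinctCycleEdges (G.induce S) := by
  have hle : ∀ v : S, ((G.induce S).neighborSet v).ncard ≤ 3 := fun v => by
    rw [ncard_neighborSet_induce, ← h3 v]
    exact Set.ncard_le_ncard Set.inter_subset_left
  refine le_numDistinctCycleEdges_of_ncard_neighborSet_le (D := 3)
    (h.connected_induce hG).preconnected hle ⟨⟨b₁, h.mem_crossing₁.1⟩, ?_⟩ ?_ ?_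
  · rw [ncard_neighborSet_induce, ← h3 b₁]
    exact (Set.ncard_lt_ncard (Set.inter_ssubset_left_iff.2
      fun hsub => h.mem_crossing₁.2.1 (hsub h.mem_crossing₁.2.2))).ne
  · intro u v _ _ huv
    rw [mem_cycleEdges_iff huv]
    by_contra hr
    exact hS ⟨_, huv, isBridge_iff.2 hr⟩
  · refine (Nat.mul_le_mul_right _ ?_).trans_lt hM
    rw [← Set.ncard_image_of_injective _ Subtype.val_injective]
    refine (Set.ncard_le_ncard (t := {b₁, b₂}) ?_).trans ((Set.ncard_insert_le _ _).trans (by simp))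
    rintro _ ⟨v, hv, rfl⟩
    by_contra hvb
    refine hv ?_
    rw [ncard_neighborSet_induce, Set.inter_eq_left.2, h3]
    intro w hw
    by_contra hwS
    exact hvb ((h.eq_or_eq_of_adj v.2 hwS hw).imp And.left And.left)

namespace Split

variable (s : Split G)

lemma le_numDistinctCycleEdges_extGraph_of_lt_ncard_side (hG : G.IsEdgeConnected 2)
    (h3 : IsCubic G) {M : ℕ} (hM : 3 * 4 ^ M < s.side.ncard) :
    M ≤ numDistinctCycleEdges s.extGraph := by
  have hinl := fun v => s.ncard_neighborSet_extGraph_inl hG h3 (v := v)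
  have hinr := fun v => s.ncard_neighborSet_extGraph_inr (v := v)
  have hdeg : ∀ v : s.extSide, (s.extGraph.neighborSet v).ncard = 3 ↔ v.1.isLeft := fun v => by
    refine ⟨fun hv => ?_, hinl v⟩
    by_contra hv'
    have := hinr v (by simpa using hv')
    omega
  refine le_numDistinctCycleEdges_of_ncard_neighborSet_le (D := 3) (s.preconnected_extGraph hG h3)
    (fun v => ?_) ⟨⟨.inr 1, by simp⟩, by simp [hdeg]⟩ (fun u v hu hv huv => ?_) ?_
  · by_cases hv : v.1.isLeft
    · exact (hinl v hv).le
    · exact (hinr v (by simpa using hv)).le.trans (Nat.le_succ 2)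
  · exact s.mem_cycleEdges_extGraph hG h3 huv ((hdeg u).1 hu) ((hdeg v).1 hv)
  · have hT : {v | (s.extGraph.neighborSet v).ncard ≠ 3}.ncard ≤ 3 := by
      rw [← Set.ncard_image_of_injective _ Subtype.val_injective]
      refine (Set.ncard_le_ncard (t := {.inr 1, .inr 2, .inr 3}) ?_).trans (by simp)
      rintro _ ⟨⟨v, hv⟩, hv', rfl⟩
      rw [Set.mem_ofPred_eq, ne_eq, hdeg] at hv'
      rcases v with v | k
      · simp at hv'
      · have := s.inr_mem_extSide.1 hv
        simp
        omega
    have hcard : s.side.ncard ≤ Nat.card s.extSide := by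
      rw [← Set.ncard_image_of_injective s.side (Sum.inl_injective (β := Fin 4)),
        Nat.card_coe_set_eq]
      exact Set.ncard_le_ncard Set.subset_union_left
    exact ((Nat.mul_le_mul_right _ hT).trans_lt hM).trans_le hcard

lemma not_hasBridge_compl (hG : G.IsEdgeConnected 2) (hside : 2 * s.side.ncard < s.sideᶜ.ncard) :
    ¬ HasBridge (G.induce s.sideᶜ) := by
  intro hbr
  obtain ⟨A, hA, ⟨u, v⟩, huv⟩ := exists_crossing_sdiff_eq_singleton hbr
  have hmem : (u, v) ∈ crossing G A (s.sideᶜ \ A) := huv ▸ rfl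
  have hcut := ncard_crossing_compl_add_ncard_crossing_compl (G := G)
    (disjoint_sdiff_self_right (x := A) (y := s.sideᶜ))
  rw [Set.union_sdiff_cancel hA, s.isTwoCut.compl.ncard_crossing, huv, Set.ncard_singleton] at hcut
  have hcompl : ∀ {X}, X ⊆ s.sideᶜ → Xᶜ.Nonempty := fun hX => ⟨s.b₁, fun hb => hX hb s.b₁_mem⟩
  have hA₂ := Set.one_lt_ncard_iff_nontrivial.2
    (crossing_compl_nontrivial hG ⟨u, hmem.1⟩ (hcompl hA))
  have hB₂ := Set.one_lt_ncard_iff_nontrivial.2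
    (crossing_compl_nontrivial hG ⟨v, hmem.2.1⟩ (hcompl Set.sdiff_subset))
  have heven : ∀ {X}, (crossing G X Xᶜ).ncard = 2 → imbalance s.side ≤ imbalance X := fun hX => by
    obtain ⟨_, _, _, _, h⟩ := exists_isTwoCut_of_ncard_crossing hX
    exact s.most_even _ _ _ (h.isBibridge hG) (h.isPart hG)
  have hAe := heven (X := A) (by omega)
  have hBe := heven (X := s.sideᶜ \ A) (by omega)
  have hsum := Set.ncard_sdiff_add_ncard_of_subset hA
  have hApos : 0 < A.ncard := (Set.ncard_pos).2 ⟨u, hmem.1⟩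
  have hBpos : 0 < (s.sideᶜ \ A).ncard := (Set.ncard_pos).2 ⟨v, hmem.2.1⟩
  have := Set.ncard_add_ncard_compl A
  have := Set.ncard_add_ncard_compl (s.sideᶜ \ A)
  have := Set.ncard_add_ncard_compl s.side
  unfold imbalance at hAe hBe
  omega

/-- A number of vertices that forces `M` distinct edges on cycles of `G₁'`. Either the chosen part
has more than `K := 3 * 4 ^ M` vertices, or its complement is so large that it has more than
`K ^ 2` distinct edges on cycles, while the chosen part has at most `K ^ 2` edges at all. -/
def growthBound (M : ℕ) : ℕ :=
  3 * (3 * 4 ^ M) + 2 * 4 ^ ((3 * 4 ^ M) ^ 2 + 1) + 1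

lemma le_numDistinctCycleEdges_extGraph (hG : G.IsEdgeConnected 2) (h3 : IsCubic G) {M : ℕ}
    (hM : growthBound M ≤ Nat.card V) : M ≤ numDistinctCycleEdges s.extGraph := by
  by_contra hlt
  have hside : s.side.ncard ≤ 3 * 4 ^ M :=
    not_lt.1 (mt (s.le_numDistinctCycleEdges_extGraph_of_lt_ncard_side hG h3) hlt)
  unfold growthBound at hM
  set K := 3 * 4 ^ M
  have hcard := Set.ncard_add_ncard_compl s.side
  have hcompl : K ^ 2 + 1 ≤ numDistinctCycleEdges (G.induce s.sideᶜ) :=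
    s.isTwoCut.compl.le_numDistinctCycleEdges_induce hG h3
      (s.not_hasBridge_compl hG (by omega)) (by omega)
  refine (hcompl.trans (s.more_distinct.trans ?_)).not_gt (Nat.lt_succ_self _)
  exact numDistinctCycleEdges_le.trans (Nat.pow_le_pow_left hside 2)

end Split

end Size

section Choices

variable {V : Type*} {G : SimpleGraph V}

namespace Split

variable (s : Split G)

/-- The edge `xy` of `G` can be inserted: it lies in the chosen part, and `xn₃` and `yn₄` are not
edges of `G'`. -/
structure IsInsertable (x y : V) : Prop where
  adj : G.Adj x y
  fst_mem : x ∈ s.side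
  snd_mem : y ∈ s.side
  fst_ne : x ≠ s.b₁
  snd_ne : y ≠ s.b₂

variable {s}

lemma isLeft_of_mem_candidateEdges {u v : s.extSide} (h : s(u, v) ∈ s.candidateEdges) :
    u.1.isLeft := by
  have hadj : s.splitGraph.Adj u v := cycleEdges_subset_edgeSet h.1
  have hu := h.2 u (Sym2.mem_mk_left u v)
  have hv := h.2 v (Sym2.mem_mk_right u v)
  rw [splitGraph_eq] at hadj
  obtain ⟨u | k, hu'⟩ := u
  · rfl
  obtain ⟨v | l, hv'⟩ := v <;>
    simp only [reattach_adj_inr_inl, mem_trades, reattach_adj_inr_inr, starGraph_adj,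
      inr_mem_extSide, ne_eq, Sum.inr.injEq] at hadj hu hv hu' hv' <;>
    grind

lemma exists_inl_of_mem_candidateEdges {u v : s.extSide} (h : s(u, v) ∈ s.candidateEdges) :
    ∃ x ∈ s.side, ∃ y ∈ s.side, u.1 = .inl x ∧ v.1 = .inl y ∧ G.Adj x y := by
  have hadj : s.splitGraph.Adj u v := cycleEdges_subset_edgeSet h.1
  obtain ⟨x, hx⟩ := Sum.isLeft_iff.1 (isLeft_of_mem_candidateEdges h)
  obtain ⟨y, hy⟩ := Sum.isLeft_iff.1 (isLeft_of_mem_candidateEdges (Sym2.eq_swap ▸ h))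
  rw [splitGraph_eq, hx, hy] at hadj
  exact ⟨x, s.inl_mem_extSide.1 (hx ▸ u.2), y, s.inl_mem_extSide.1 (hy ▸ v.2), hx, hy, hadj.1⟩

lemma splitGraph_adj_inr_two_iff {v : V} :
    s.splitGraph.Adj (.inl v) (.inr 2) ↔ v = s.b₁ := by
  simp [splitGraph_eq, mem_trades]

lemma splitGraph_adj_inr_three_iff {v : V} :
    s.splitGraph.Adj (.inl v) (.inr 3) ↔ v = s.b₂ := by
  simp [splitGraph_eq, mem_trades]

lemma Admissible.exists_isInsertable {d : s.extGraph.Dart} (hd : s.Admissible d) :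
    ∃ x y, d.fst.1 = .inl x ∧ d.snd.1 = .inl y ∧ s.IsInsertable x y := by
  obtain ⟨x, hxs, y, hys, hx, hy, hxy⟩ := exists_inl_of_mem_candidateEdges hd.mem
  have hxb := hd.fst_not_adj
  have hyb := hd.snd_not_adj
  rw [hx, splitGraph_adj_inr_two_iff] at hxb
  rw [hy, splitGraph_adj_inr_three_iff] at hyb
  exact ⟨x, y, hx, hy, hxy, hxs, hys, hxb, hyb⟩

lemma exists_admissible (hG : G.IsEdgeConnected 2) (h3 : IsCubic G) {e : Sym2 s.extSide}
    (he : e ∈ s.candidateEdges) : ∃ d, s.Admissible d ∧ d.edge = e := by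
  have hb := s.isTwoCut.b_ne hG h3
  induction e with | h u v
  have huv : s.extGraph.Adj u v := cycleEdges_subset_edgeSet he.1
  obtain ⟨x, -, y, -, hx, hy, hxy⟩ := exists_inl_of_mem_candidateEdges he
  by_cases h : x = s.b₁ ∨ y = s.b₂
  · have hyx : y ≠ s.b₁ ∧ x ≠ s.b₂ := by
      have := hxy.ne
      grind
    exact ⟨⟨(v, u), huv.symm⟩, ⟨by simpa [Dart.edge, Sym2.eq_swap] using he,
      by simpa [hy, splitGraph_adj_inr_two_iff] using hyx.1,
      by simpa [hx, splitGraph_adj_inr_three_iff] using hyx.2⟩, Sym2.eq_swap⟩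
  · rw [not_or] at h
    exact ⟨⟨(u, v), huv⟩, ⟨he, by simpa [hx, splitGraph_adj_inr_two_iff] using h.1,
      by simpa [hy, splitGraph_adj_inr_three_iff] using h.2⟩, rfl⟩

lemma exists_run (s : Split G) (hG : G.IsEdgeConnected 2) (h3 : IsCubic G) :
    ∃ r : Run G, r.toSplit = s := by
  let r : Setoid s.candidateEdges :=
    ⟨fun e f => Similar s.extGraph e f, fun e => similar_refl e.1, Similar.symm, Similar.trans⟩
  have hex : ∀ q : Quotient r, ∃ d, s.Admissible d ∧ d.edge = q.out.1 := fun q =>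
    exists_admissible hG h3 q.out.2
  choose d hd hde using hex
  refine ⟨⟨s, Set.range d, Set.forall_mem_range.2 hd,
    fun e he => ⟨d ⟦⟨e, he⟩⟧, ⟨⟨_, rfl⟩, ?_⟩, ?_⟩⟩, rfl⟩
  · rw [hde]
    exact Setoid.symm (Quotient.mk_out (s := r) ⟨e, he⟩)
  · rintro _ ⟨⟨q, rfl⟩, hq⟩
    rw [hde] at hq
    have : q = ⟦⟨e, he⟩⟧ := q.out_eq.symm.trans (Quotient.sound (s := r) hq.symm)
    rw [this]

end Split

lemma Run.numDistinctCycleEdges_le_ncard_darts [Finite V] (r : Run G) :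
    numDistinctCycleEdges r.extGraph ≤ r.darts.ncard + 4 := by
  have : Finite r.extGraph.Dart := Finite.of_injective _ Dart.toProd_injective
  let cl : Sym2 r.extSide → Set (Sym2 r.extSide) := fun e => {f | Similar r.extGraph e f}
  let n₃ : r.extSide := ⟨.inr 2, by simp⟩
  let n₄ : r.extSide := ⟨.inr 3, by simp⟩
  have hsub : cl '' cycleEdges r.extGraph ⊆ (fun d : r.extGraph.Dart => cl d.edge) '' r.darts ∪
      ((fun w => cl s(n₃, w)) '' r.extGraph.neighborSet n₃ ∪
        (fun w => cl s(n₄, w)) '' r.extGraph.neighborSet n₄) := by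
    rintro _ ⟨e, he, rfl⟩
    by_cases hcand : e ∈ r.candidateEdges
    · obtain ⟨d, ⟨hd, hsim⟩, -⟩ := r.existsUnique e hcand
      exact .inl ⟨d, hd, (setOf_similar_eq_iff.2 hsim).symm⟩
    · obtain ⟨v, ⟨w, rfl⟩, hv⟩ : ∃ v ∈ e, v = n₃ ∨ v = n₄ := by
        by_contra! hn
        exact hcand ⟨he, fun v hv => ⟨fun h => (hn v hv).1 (Subtype.ext h),
          fun h => (hn v hv).2 (Subtype.ext h)⟩⟩
      have hvw := cycleEdges_subset_edgeSet he
      rcases hv with rfl | rfl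
      exacts [.inr (.inl ⟨w, hvw, rfl⟩), .inr (.inr ⟨w, hvw, rfl⟩)]
  have hn₃ := r.ncard_neighborSet_extGraph_inr (v := n₃) rfl
  have hn₄ := r.ncard_neighborSet_extGraph_inr (v := n₄) rfl
  calc numDistinctCycleEdges r.extGraph
      ≤ _ := Set.ncard_le_ncard hsub
    _ ≤ _ := (Set.ncard_union_le _ _).trans (Nat.add_le_add_left (Set.ncard_union_le _ _) _)
    _ ≤ r.darts.ncard + (2 + 2) := by
      refine add_le_add Set.ncard_image_le (add_le_add ?_ ?_)
      · exact (Set.ncard_image_le).trans hn₃.le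
      · exact (Set.ncard_image_le).trans hn₄.le

end Choices

section Output

variable {V : Type*} {G : SimpleGraph V}

lemma ncard_neighborSet_starGraph_one (k : Fin 4) :
    ((starGraph 1).neighborSet k).ncard = if k = 1 then 3 else 1 := by
  rw [Set.ncard_eq_toFinset_card']
  revert k
  decide

namespace Split

variable {s : Split G} {x y : V}

lemma IsInsertable.isReattachment (h : s.IsInsertable x y) (hG : G.IsEdgeConnected 2)
    (h3 : IsCubic G) : IsReattachment G (trade s.trades x y 2 3) := by
  have ha₁ := s.a₁_notMem
  have ha₂ := s.a₂_notMem
  obtain ⟨hadj, hx, hy, hxb, hyb⟩ := h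
  refine (s.isReattachment_trades hG h3).trade hadj ?_ ?_ ?_ <;>
    simp only [mem_trades] <;> grind

lemma isBridge_insertion (d : s.extGraph.Dart) :
    (s.insertion d).IsBridge s(.inr 1, .inr 0) ∧ (s.insertion d).Adj (.inr 1) (.inr 0) := by
  have hcut : crossing (s.insertion d) s.extSide s.extSideᶜ = {(.inr 1, .inr 0)} := by
    rw [← s.crossing_splitGraph]
    ext ⟨p, q⟩
    simp only [mem_crossing]
    refine and_congr_right fun hp => and_congr_right fun hq => ?_
    have := d.fst.2
    have := d.snd.2
    have : (.inr 2 : V ⊕ Fin 4) ∈ s.extSide := by simp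
    have : (.inr 3 : V ⊕ Fin 4) ∈ s.extSide := by simp
    simp only [insertion, sup_adj, deleteEdges_adj, fromEdgeSet_adj, Set.mem_insert_iff,
      Set.mem_singleton_iff, Sym2.eq_iff]
    grind
  have hadj : (s.insertion d).Adj (.inr 1) (.inr 0) :=
    (Set.ext_iff.1 hcut (.inr 1, .inr 0)).2 rfl |>.2.2
  exact ⟨(isBridge_iff_exists_crossing_eq hadj).2 ⟨_, hcut⟩, hadj⟩

lemma hasBridge_insertion (d : s.extGraph.Dart) : HasBridge (s.insertion d) :=
  ⟨_, (isBridge_insertion d).2, (isBridge_insertion d).1⟩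

lemma IsInsertable.connected_reattach (h : s.IsInsertable x y) (hG : G.IsEdgeConnected 2)
    (h3 : IsCubic G) : (reattach G (starGraph 1) (trade s.trades x y 2 3)).Connected :=
  have : Nonempty V := ⟨x⟩
  (h.isReattachment hG h3).connected (hG.connected two_ne_zero)
    (connected_starGraph 1).preconnected ⟨_, mem_trade.2 (.inl ⟨rfl, rfl, rfl⟩)⟩

lemma IsInsertable.isCubic_reattach [Finite V] (h : s.IsInsertable x y) (hG : G.IsEdgeConnected 2)
    (h3 : IsCubic G) : IsCubic (reattach G (starGraph 1) (trade s.trades x y 2 3)) := by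
  have ha := s.isTwoCut.a_ne hG h3
  have hends : ∀ k : Fin 4, {v | ∃ w, (v, w, k) ∈ trade s.trades x y 2 3} =
      ![{s.a₁, s.a₂}, ∅, {x, s.b₁}, {y, s.b₂}] k := by
    intro k
    ext v
    simp only [mem_trade, mem_trades, Set.mem_ofPred_eq]
    fin_cases k <;> simp <;> grind
  rintro (v | k)
  · rw [(h.isReattachment hG h3).ncard_neighborSet_inl, h3]
  · rw [ncard_neighborSet_reattach_inr, ncard_neighborSet_starGraph_one, hends]
    fin_cases k <;> simp [ha, h.fst_ne, h.snd_ne]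

lemma Admissible.connected_insertion {d : s.extGraph.Dart} (hd : s.Admissible d)
    (hG : G.IsEdgeConnected 2) (h3 : IsCubic G) : (s.insertion d).Connected := by
  obtain ⟨x, y, hx, hy, h⟩ := hd.exists_isInsertable
  rw [s.insertion_eq hx hy]
  exact h.connected_reattach hG h3

lemma Admissible.isCubic_insertion [Finite V] {d : s.extGraph.Dart} (hd : s.Admissible d)
    (hG : G.IsEdgeConnected 2) (h3 : IsCubic G) : IsCubic (s.insertion d) := by
  obtain ⟨x, y, hx, hy, h⟩ := hd.exists_isInsertable
  rw [s.insertion_eq hx hy]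
  exact h.isCubic_reattach hG h3

end Split

end Output

section Rigidity

variable {V V' K : Type*} {G : SimpleGraph V} {G' : SimpleGraph V'} {T : SimpleGraph K}
  {R : Set (V × V × K)} {R' : Set (V' × V' × K)}

lemma map_mem_cycleEdges (φ : G ≃g G') {e : Sym2 V} (he : e ∈ cycleEdges G) :
    e.map φ ∈ cycleEdges G' := by
  obtain ⟨u, p, hp, he⟩ := he
  refine ⟨φ u, p.map φ.toHom, hp.map φ.injective, ?_⟩
  rw [Walk.edges_map]
  exact List.mem_map_of_mem he

lemma inr_mem_setBall_reattach_starGraph {c : K} (k l : K) :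
    .inr l ∈ setBall (reattach G (starGraph c) R) {.inr k} 2 := by
  have hball : ∀ {i j n}, .inr i ∈ setBall (reattach G (starGraph c) R) {.inr k} n →
      (i = c ∨ j = c) → .inr j ∈ setBall (reattach G (starGraph c) R) {.inr k} (n + 1) :=
    fun {i j n} hi hij => by
      by_cases h : i = j
      · exact setBall_mono _ n.le_succ (h ▸ hi)
      · exact mem_setBall_succ_of_adj hi (by simpa [h] using hij)
  exact hball (hball (n := 0) (j := c) rfl (.inr rfl)) (.inl rfl)

lemma inl_mem_setBall_reattach_starGraph {c : K} (k : K) {l : K} {v w : V} (h : (v, w, l) ∈ R) :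
    .inl v ∈ setBall (reattach G (starGraph c) R) {.inr k} 3 :=
  mem_setBall_succ_of_adj (inr_mem_setBall_reattach_starGraph k l) ⟨w, h⟩

lemma IsReattachment.exists_apply_inr_mem_range (hR' : IsReattachment G' R')
    (hG' : G'.IsEdgeConnected 2) (hT : T.Preconnected) (φ : reattach G T R ≃g reattach G' T R')
    {k l : K} (hkl : T.Adj k l) (hcyc : s(.inr k, .inr l) ∉ cycleEdges (reattach G T R)) :
    ∃ j, φ (.inr j) ∈ Set.range Sum.inr := by
  by_contra! hφ
  have hleft : ∀ j, ∃ v, φ (.inr j) = .inl v := fun j => by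
    rcases h : φ (.inr j) with v | i
    · exact ⟨v, rfl⟩
    · exact (hφ j ⟨i, h.symm⟩).elim
  obtain ⟨v, hv⟩ := hleft k
  obtain ⟨w, hw⟩ := hleft l
  have hvw : (reattach G' T R').Adj (.inl v) (.inl w) := by
    rwa [← hv, ← hw, φ.map_adj_iff]
  have := map_mem_cycleEdges φ.symm (hR'.mem_cycleEdges hG' hT hvw)
  rw [← hv, ← hw] at this
  exact hcyc (by simpa using this)

/-- The isomorphism of the reattached graphs that extends an isomorphism respecting the trades. -/
def reattachIso (T : SimpleGraph K) (σ : G ≃g G')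
    (hσ : ∀ v w k, (v, w, k) ∈ R ↔ (σ v, σ w, k) ∈ R') : reattach G T R ≃g reattach G' T R' where
  toEquiv := σ.toEquiv.sumCongr (.refl K)
  map_rel_iff' := by
    rintro (v | k) (w | l)
    · simpa [hσ] using fun _ => σ.map_adj_iff
    all_goals simp [hσ, σ.surjective.exists]

end Rigidity

section Ends

variable {V V' : Type*} {G' : SimpleGraph V'} {G : SimpleGraph V}

/-- The trades that turn `G` into an output, where `e` lists `a₁, b₁, a₂, b₂, x, y`. -/
def endTrades (e : Fin 6 → V) : Set (V × V × Fin 4) :=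
  trade (trade (trade ∅ (e 0) (e 1) 0 2) (e 2) (e 3) 0 3) (e 4) (e 5) 2 3

lemma mem_endTrades_comp {σ : V → V'} (hσ : σ.Injective) (e : Fin 6 → V) (v w : V) (k : Fin 4) :
    (v, w, k) ∈ endTrades e ↔ (σ v, σ w, k) ∈ endTrades (σ ∘ e) := by
  simp [endTrades, mem_trade, hσ.eq_iff]

lemma exists_mem_endTrades (e : Fin 6 → V) (i : Fin 6) : ∃ w k, (e i, w, k) ∈ endTrades e := by
  refine ⟨e (![1, 0, 3, 2, 5, 4] i), ![0, 2, 0, 3, 2, 3] i, ?_⟩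
  fin_cases i <;> simp [endTrades, mem_trade]

lemma exists_iso_of_apply_map_eq {e : Fin 6 → V} {e' : Fin 6 → V'} {T : SimpleGraph (Fin 4)}
    (h : IsReattachment G (endTrades e)) (h' : IsReattachment G' (endTrades e'))
    (ψ : reattach G T (endTrades e) ≃g reattach G' T (endTrades e'))
    (hψ : ψ ∘ Sum.map e id = Sum.map e' id) : ∃ σ : G ≃g G', σ ∘ e = e' := by
  obtain ⟨σ, hσ⟩ := exists_equiv_inl_of_inr ψ.toEquiv fun k => congrFun hψ (.inr k)
  have he : σ ∘ e = e' := funext fun i =>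
    Sum.inl_injective ((hσ (e i)).symm.trans (congrFun hψ (.inl i)))
  subst he
  exact ⟨⟨σ, fun {v w} => h.adj_iff_of_iso h' ψ hσ (mem_endTrades_comp σ.injective e) v w⟩, rfl⟩

lemma apply_map_mem_setBall {e : Fin 6 → V} {e' : Fin 6 → V'}
    (h' : IsReattachment G' (endTrades e')) (hG' : G'.IsEdgeConnected 2)
    (φ : reattach G (starGraph 1) (endTrades e) ≃g reattach G' (starGraph 1) (endTrades e'))
    (hcyc : s(.inr 1, .inr 0) ∉ cycleEdges (reattach G (starGraph 1) (endTrades e)))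
    (p : Fin 6 ⊕ Fin 4) :
    φ (p.map e id) ∈ setBall (reattach G' (starGraph 1) (endTrades e')) (Set.range Sum.inr) 3 := by
  obtain ⟨j, hj⟩ := h'.exists_apply_inr_mem_range hG' (connected_starGraph 1).preconnected φ
    (by simp) hcyc
  refine mapsTo_setBall φ.toHom (T := {.inr j}) (by simpa using hj) 3 ?_
  rcases p with i | k
  · obtain ⟨w, k, hk⟩ := exists_mem_endTrades e i
    exact inl_mem_setBall_reattach_starGraph j hk
  · exact setBall_mono _ (Nat.le_succ 2) (inr_mem_setBall_reattach_starGraph j k)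

end Ends

section Labels

variable {V V' : Type*} {G : SimpleGraph V} {G' : SimpleGraph V'} {s : Split G} {s' : Split G'}
  {d : s.extGraph.Dart} {d' : s'.extGraph.Dart} {e : Fin 6 → V} {e' : Fin 6 → V'}

namespace Split

/-- The tuple `e` lists the vertices `a₁, b₁, a₂, b₂, x, y` of `G` at which the output that belongs
to the ordered edge `d = xy` differs from `G`. -/
structure IsEnds (s : Split G) (d : s.extGraph.Dart) (e : Fin 6 → V) : Prop where
  eq_a₁ : e 0 = s.a₁
  eq_b₁ : e 1 = s.b₁
  eq_a₂ : e 2 = s.a₂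
  eq_b₂ : e 3 = s.b₂
  fst_eq : d.fst.1 = .inl (e 4)
  snd_eq : d.snd.1 = .inl (e 5)
  isInsertable : s.IsInsertable (e 4) (e 5)

lemma Admissible.exists_isEnds (hd : s.Admissible d) : ∃ e, s.IsEnds d e := by
  obtain ⟨x, y, hx, hy, h⟩ := hd.exists_isInsertable
  exact ⟨![s.a₁, s.b₁, s.a₂, s.b₂, x, y], rfl, rfl, rfl, rfl, hx, hy, h⟩

namespace IsEnds

lemma endTrades_eq (h : s.IsEnds d e) : endTrades e = trade s.trades (e 4) (e 5) 2 3 := by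
  rw [endTrades, trades, h.eq_a₁, h.eq_b₁, h.eq_a₂, h.eq_b₂]

lemma isReattachment (h : s.IsEnds d e) (hG : G.IsEdgeConnected 2) (h3 : IsCubic G) :
    IsReattachment G (endTrades e) := by
  rw [h.endTrades_eq]
  exact h.isInsertable.isReattachment hG h3

lemma insertion_eq (h : s.IsEnds d e) :
    s.insertion d = reattach G (starGraph 1) (endTrades e) := by
  rw [h.endTrades_eq, s.insertion_eq h.fst_eq h.snd_eq]

lemma apply_map_mem_setBall (h : s.IsEnds d e) (h' : s'.IsEnds d' e')
    (hG' : G'.IsEdgeConnected 2) (h3' : IsCubic G') (φ : s.insertion d ≃g s'.insertion d')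
    (p : Fin 6 ⊕ Fin 4) :
    φ (p.map e id) ∈ setBall (s'.insertion d') (Set.range Sum.inr) 3 := by
  have hcyc : s(.inr 1, .inr 0) ∉ cycleEdges (s.insertion d) := fun hc =>
    (isBridge_iff.1 (s.isBridge_insertion d).1)
      ((mem_cycleEdges_iff (s.isBridge_insertion d).2).1 hc)
  revert φ hcyc
  rw [h.insertion_eq, h'.insertion_eq]
  exact fun φ hcyc =>
    BridgeConstruction.apply_map_mem_setBall (h'.isReattachment hG' h3') hG' φ hcyc p

lemma exists_iso (h : s.IsEnds d e) (h' : s'.IsEnds d' e') (hG : G.IsEdgeConnected 2)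
    (h3 : IsCubic G) (hG' : G'.IsEdgeConnected 2) (h3' : IsCubic G')
    (ψ : s.insertion d ≃g s'.insertion d') (hψ : ψ ∘ Sum.map e id = Sum.map e' id) :
    ∃ σ : G ≃g G', σ ∘ e = e' := by
  revert ψ
  rw [h.insertion_eq, h'.insertion_eq]
  exact fun ψ hψ =>
    exists_iso_of_apply_map_eq (h.isReattachment hG h3) (h'.isReattachment hG' h3') ψ hψ

end IsEnds

lemma apply_mem_side_iff (hG : G.IsEdgeConnected 2) {σ : G ≃g G}
    (hσ : ∀ v ∈ ({s.a₁, s.b₁, s.a₂, s.b₂} : Set V), σ v = v) (v : V) :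
    σ v ∈ s.side ↔ v ∈ s.side := by
  simp only [Set.forall_mem_insert, Set.mem_singleton_iff, forall_eq] at hσ
  obtain ⟨ha₁, hb₁, ha₂, hb₂⟩ := hσ
  have hedge : ∀ {u w x y}, σ x = x → σ y = y → (s(σ u, σ w) = s(x, y) ↔ s(u, w) = s(x, y)) :=
    fun {u w x y} hx hy =>
      (Sym2.map.injective σ.injective).eq_iff' (a := s(u, w)) (b := s(x, y))
        (congrArg₂ (s(·, ·)) hx hy)
  let τ : G.deleteEdges {s(s.a₁, s.b₁), s(s.a₂, s.b₂)} ≃g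
      G.deleteEdges {s(s.a₁, s.b₁), s(s.a₂, s.b₂)} :=
    ⟨σ.toEquiv, by simp [deleteEdges_adj, σ.map_adj_iff, hedge ha₁ hb₁, hedge ha₂ hb₂]⟩
  have hreach := τ.reachable_iff (u := s.b₁) (v := v)
  rw [show τ s.b₁ = s.b₁ from hb₁] at hreach
  have hcut := s.isTwoCut
  rwa [hcut.reachable_deleteEdges_iff hG s.b₁_mem, hcut.reachable_deleteEdges_iff hG s.b₁_mem]
    at hreach

/-- The automorphism of `G₁'` induced by an automorphism of `G` that fixes the bi-bridge. -/
def extGraphAut (hG : G.IsEdgeConnected 2) (σ : G ≃g G)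
    (hσ : ∀ v ∈ ({s.a₁, s.b₁, s.a₂, s.b₂} : Set V), σ v = v) : s.extGraph ≃g s.extGraph where
  toEquiv := (σ.toEquiv.sumCongr (.refl (Fin 4))).subtypeEquiv (by
    rintro (v | k)
    · simpa using (apply_mem_side_iff hG hσ v).symm
    · simp)
  map_rel_iff' := by
    simp only [Set.forall_mem_insert, Set.mem_singleton_iff, forall_eq] at hσ
    obtain ⟨ha₁, hb₁, ha₂, hb₂⟩ := hσ
    have htrades : ∀ v w k, (v, w, k) ∈ s.trades ↔ (σ v, σ w, k) ∈ s.trades := fun v w k => by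
      simp only [mem_trades, σ.injective.eq_iff' ha₁, σ.injective.eq_iff' hb₁,
        σ.injective.eq_iff' ha₂, σ.injective.eq_iff' hb₂]
    rintro ⟨p, hp⟩ ⟨q, hq⟩
    change s.splitGraph.Adj (p.map σ id) (q.map σ id) ↔ s.splitGraph.Adj p q
    rw [s.splitGraph_eq]
    exact (reattachIso (starGraph 1) σ htrades).map_adj_iff

lemma IsEnds.similar {d d' : s.extGraph.Dart} {e e' : Fin 6 → V} (h : s.IsEnds d e)
    (h' : s.IsEnds d' e') (hG : G.IsEdgeConnected 2) {σ : G ≃g G} (hσ : σ ∘ e = e') :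
    Similar s.extGraph d.edge d'.edge := by
  have hfix : ∀ v ∈ ({s.a₁, s.b₁, s.a₂, s.b₂} : Set V), σ v = v := by
    have := congrFun hσ
    simp only [Function.comp_apply] at this
    simp only [Set.forall_mem_insert, Set.mem_singleton_iff, forall_eq]
    refine ⟨?_, ?_, ?_, ?_⟩
    · rw [← h.eq_a₁, this, h'.eq_a₁, h.eq_a₁]
    · rw [← h.eq_b₁, this, h'.eq_b₁, h.eq_b₁]
    · rw [← h.eq_a₂, this, h'.eq_a₂, h.eq_a₂]
    · rw [← h.eq_b₂, this, h'.eq_b₂, h.eq_b₂]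
  have hfst : extGraphAut hG σ hfix d.fst = d'.fst := Subtype.ext <| by
    simp [extGraphAut, h.fst_eq, h'.fst_eq, ← hσ]
  have hsnd : extGraphAut hG σ hfix d.snd = d'.snd := Subtype.ext <| by
    simp [extGraphAut, h.snd_eq, h'.snd_eq, ← hσ]
  exact ⟨extGraphAut hG σ hfix, congrArg₂ (s(·, ·)) hfst hsnd⟩

end Split

end Labels

section Counting

variable {ι : Type*} {V : ι → Type*} {G : ∀ i, SimpleGraph (V i)}

/-- A bound for the number of ways to place ten labels in a ball of radius `3` around four vertices
of a cubic graph. -/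
def labelBound : ℕ := 256 ^ 10

/-- Isomorphism of outputs, as an equivalence relation on all outputs of a family of runs. -/
def outputSetoid (r : ∀ i, Run (G i)) : Setoid (Σ i, (r i).darts) where
  r p q := Nonempty ((r p.1).output p.2 ≃g (r q.1).output q.2)
  iseqv := ⟨fun _ => ⟨Iso.refl⟩, fun ⟨φ⟩ => ⟨φ.symm⟩, fun ⟨φ⟩ ⟨ψ⟩ => ⟨φ.trans ψ⟩⟩

lemma eq_of_apply_map_eq (hG : ∀ i, (G i).IsEdgeConnected 2) (h3 : ∀ i, IsCubic (G i))
    (hiso : ∀ i j, i ≠ j → IsEmpty (G i ≃g G j)) (r : ∀ i, Run (G i)) {p q : Σ i, (r i).darts}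
    {e : Fin 6 → V p.1} {e' : Fin 6 → V q.1} (he : (r p.1).IsEnds p.2 e)
    (he' : (r q.1).IsEnds q.2 e') (ψ : (r p.1).output p.2 ≃g (r q.1).output q.2)
    (hψ : ψ ∘ Sum.map e id = Sum.map e' id) : p = q := by
  obtain ⟨σ, hσ⟩ := he.exists_iso he' (hG _) (h3 _) (hG _) (h3 _) ψ hψ
  obtain ⟨i, d, hd⟩ := p
  obtain ⟨j, d', hd'⟩ := q
  obtain rfl : i = j := by
    by_contra hij
    exact (hiso i j hij).false σ
  obtain rfl : d = d' := ((r i).existsUnique d.edge ((r i).admissible d hd).mem).unique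
    ⟨hd, similar_refl _⟩ ⟨hd', he.similar he' (hG i) hσ⟩
  rfl

lemma encard_setOf_output_iso_le [∀ i, Finite (V i)] (hG : ∀ i, (G i).IsEdgeConnected 2)
    (h3 : ∀ i, IsCubic (G i)) (hiso : ∀ i j, i ≠ j → IsEmpty (G i ≃g G j)) (r : ∀ i, Run (G i))
    (p : Σ i, (r i).darts) : {q | outputSetoid r q p}.encard ≤ labelBound := by
  choose e he using fun q : Σ i, (r i).darts => ((r q.1).admissible q.2 q.2.2).exists_isEnds
  let B := setBall ((r p.1).output p.2) (Set.range Sum.inr) 3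
  have hB : B.ncard ≤ 256 :=
    calc B.ncard ≤ (Set.range Sum.inr : Set (V p.1 ⊕ Fin 4)).ncard * (3 + 1) ^ 3 :=
          ncard_setBall_le (fun v =>
            (((r p.1).admissible p.2 p.2.2).isCubic_insertion (hG _) (h3 _) v).le) _ _
      _ = 256 := by
          rw [← Set.image_univ, Set.ncard_image_of_injective _ Sum.inr_injective, Set.ncard_univ,
            Nat.card_fin]
          norm_num
  have φ : ∀ q : {q | outputSetoid r q p}, (r q.1.1).output q.1.2 ≃g (r p.1).output p.2 :=
    fun q => q.2.some
  let labels : {q | outputSetoid r q p} → Fin 6 ⊕ Fin 4 → B := fun q k =>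
    ⟨φ q (k.map (e q) id), (he q).apply_map_mem_setBall (he p) (hG _) (h3 _) (φ q) k⟩
  have hlabels : labels.Injective := fun q q' h => Subtype.ext <|
    eq_of_apply_map_eq hG h3 hiso r (he q) (he q') ((φ q).trans (φ q').symm) <| funext fun k =>
      (φ q').symm_apply_eq.2 (congrArg Subtype.val (congrFun h k))
  calc {q | outputSetoid r q p}.encard ≤ ENat.card (Fin 6 ⊕ Fin 4 → B) :=
        ENat.card_le_card_of_injective hlabels
    _ = (B.ncard ^ 10 : ℕ) := by
        rw [ENat.card_eq_coe_natCard, Nat.card_fun, Nat.card_coe_set_eq]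
        simp
    _ ≤ labelBound := mod_cast Nat.pow_le_pow_left hB 10

end Counting

section Selection

variable {ι Q : Type*} {X : ι → Type*} [∀ i, Fintype (X i)] {f : (Σ i, X i) → Q} {M C : ℕ}

lemma mul_card_le_card_image_sigma [DecidableEq Q] (hpos : 0 < C)
    (hf : ∀ b, (f ⁻¹' {b}).encard ≤ C) (hX : ∀ i, M * C ≤ Fintype.card (X i)) (I : Finset ι) :
    I.card * M ≤ ((I.sigma fun _ => Finset.univ).image f).card := by
  refine Nat.le_of_mul_le_mul_left ?_ hpos
  calc C * (I.card * M) = I.card * (M * C) := by ring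
    _ ≤ (I.sigma fun i => (Finset.univ : Finset (X i))).card := by
        rw [Finset.card_sigma, ← smul_eq_mul]
        exact Finset.card_nsmul_le_sum _ _ _ fun i _ => hX i
    _ ≤ C * ((I.sigma fun _ => Finset.univ).image f).card := by
        refine Finset.card_le_mul_card_image _ _ fun b _ => ?_
        rw [← Nat.cast_le (α := ℕ∞), ← Set.encard_coe_eq_coe_finsetCard, Finset.coe_filter]
        exact (Set.encard_le_encard fun _ hx => hx.2).trans (hf b)

lemma exists_injOn_sigma (hpos : 0 < C) (hf : ∀ b, (f ⁻¹' {b}).encard ≤ C)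
    (hX : ∀ i, M * C ≤ Fintype.card (X i)) :
    ∃ A : ∀ i, Finset (X i), (∀ i, (A i).card = M) ∧ Set.InjOn f {p | p.2 ∈ A p.1} := by
  classical
  let t : ι × Fin M → Finset Q := fun k => Finset.univ.image fun x => f ⟨k.1, x⟩
  have hall : ∀ s : Finset (ι × Fin M), s.card ≤ (s.biUnion t).card := fun s =>
    calc s.card ≤ (s.image Prod.fst ×ˢ (Finset.univ : Finset (Fin M))).card :=
          Finset.card_le_card fun p hp => by simpa using ⟨p.2, hp⟩
      _ = (s.image Prod.fst).card * M := by simp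
      _ ≤ _ := mul_card_le_card_image_sigma hpos hf hX _
      _ ≤ (s.biUnion t).card := Finset.card_le_card fun b hb => by
          simpa [t] using hb
  obtain ⟨g, hg, hgt⟩ := (Finset.all_card_le_biUnion_card_iff_exists_injective t).1 hall
  have hx : ∀ i k, ∃ x, f ⟨i, x⟩ = g (i, k) := fun i k => by simpa [t] using hgt (i, k)
  choose x hx using hx
  have hinj : ∀ {i k j l}, f ⟨i, x i k⟩ = f ⟨j, x j l⟩ → (i, k) = (j, l) := fun h =>
    hg (by rw [← hx, ← hx, h])
  refine ⟨fun i => Finset.univ.image (x i), fun i => ?_, ?_⟩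
  · rw [Finset.card_image_of_injective, Finset.card_univ, Fintype.card_fin]
    intro k l hkl
    simpa using hinj (congrArg (fun y => f ⟨i, y⟩) hkl)
  · rintro ⟨i, y⟩ hy ⟨j, z⟩ hz h
    simp only [Set.mem_ofPred_eq, Finset.mem_image, Finset.mem_univ, true_and] at hy hz
    obtain ⟨k, rfl⟩ := hy
    obtain ⟨l, rfl⟩ := hz
    cases hinj h
    rfl

end Selection

section Main

universe u v

lemma exists_finset_output_not_iso {ι : Type*} {V : ι → Type*} [∀ i, Finite (V i)]
    {G : ∀ i, SimpleGraph (V i)} (hG : ∀ i, (G i).IsEdgeConnected 2) (h3 : ∀ i, IsCubic (G i))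
    (hiso : ∀ i j, i ≠ j → IsEmpty (G i ≃g G j)) (r : ∀ i, Run (G i)) {M : ℕ}
    (hM : ∀ i, M * labelBound ≤ (r i).darts.ncard) :
    ∃ A : ∀ i, Finset (r i).extGraph.Dart,
      (∀ i, ↑(A i) ⊆ (r i).darts ∧ (A i).card = M) ∧
      (∀ i, ∀ d ∈ A i, ∀ d' ∈ A i, d ≠ d' → IsEmpty ((r i).output d ≃g (r i).output d')) ∧
      (∀ i j, i ≠ j → ∀ d ∈ A i, ∀ d' ∈ A j, IsEmpty ((r i).output d ≃g (r j).output d')) := by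
  have hfin : ∀ i, Finite (r i).extGraph.Dart := fun _ => .of_injective _ Dart.toProd_injective
  have := fun i => Fintype.ofFinite (r i).darts
  obtain ⟨A, hA, hinj⟩ := exists_injOn_sigma (f := Quotient.mk (outputSetoid r)) (M := M)
    (C := labelBound) (by simp [labelBound])
    (Quotient.ind fun p => (Set.encard_le_encard fun q hq => Quotient.exact hq).trans
      (encard_setOf_output_iso_le hG h3 hiso r p))
    fun i => by simpa [← Nat.card_eq_fintype_card, Nat.card_coe_set_eq] using hM i
  have hsel : ∀ {p q : Σ i, (r i).darts}, p.2 ∈ A p.1 → q.2 ∈ A q.1 → p ≠ q →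
      IsEmpty ((r p.1).output p.2 ≃g (r q.1).output q.2) := fun hp hq hne =>
    not_nonempty_iff.1 fun h => hne (hinj hp hq (Quotient.sound h))
  refine ⟨fun i => (A i).map (.subtype _), fun i => ⟨?_, ?_⟩, ?_, ?_⟩
  · simp
  · rw [Finset.card_map, hA]
  · simp only [Finset.mem_map, Function.Embedding.subtype_apply]
    rintro i _ ⟨d, hd, rfl⟩ _ ⟨d', hd', rfl⟩ hne
    exact hsel (p := ⟨i, d⟩) (q := ⟨i, d'⟩) hd hd' (by rintro ⟨⟩; exact hne rfl)
  · simp only [Finset.mem_map, Function.Embedding.subtype_apply]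
    rintro i j hij _ ⟨d, hd, rfl⟩ _ ⟨d', hd', rfl⟩
    exact hsel (p := ⟨i, d⟩) (q := ⟨j, d'⟩) hd hd' (by rintro ⟨⟩; exact hij rfl)

theorem theorem4p3_general :
    (∀ (V : Type u) [Finite V] (G : SimpleGraph V), IsBiconnected G → IsCubic G →
      Nonempty (Run G)) ∧
    (∀ (V : Type u) [Finite V] (G : SimpleGraph V), IsBiconnected G → IsCubic G →
      ∀ r : Run G, ∀ d ∈ r.darts, (r.output d).Connected ∧ IsCubic (r.output d) ∧
        HasBridge (r.output d) ∧ Nat.card (V ⊕ Fin 4) = Nat.card V + 4) ∧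
    (∀ M : ℕ, ∃ N : ℕ, ∀ (V : Type u) [Finite V], N ≤ Nat.card V → ∀ G : SimpleGraph V,
      IsBiconnected G → IsCubic G → ∀ r : Run G, M ≤ numDistinctCycleEdges r.extGraph) ∧
    (∀ M : ℕ, ∃ N : ℕ, ∀ (ι : Type v) (V : ι → Type u) [∀ i, Finite (V i)],
      (∀ i, N ≤ Nat.card (V i)) → ∀ G : ∀ i, SimpleGraph (V i),
      (∀ i, IsBiconnected (G i)) → (∀ i, IsCubic (G i)) →
      (∀ i j, i ≠ j → IsEmpty (G i ≃g G j)) →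
      ∀ r : ∀ i, Run (G i), ∃ A : ∀ i, Finset (r i).extGraph.Dart,
        (∀ i, ↑(A i) ⊆ (r i).darts ∧ (A i).card = M) ∧
        (∀ i, ∀ d ∈ A i, ∀ d' ∈ A i, d ≠ d' → IsEmpty ((r i).output d ≃g (r i).output d')) ∧
        (∀ i j, i ≠ j → ∀ d ∈ A i, ∀ d' ∈ A j, IsEmpty ((r i).output d ≃g (r j).output d'))) := by
  refine ⟨fun V _ G hG h3 => ?_, fun V _ G hG h3 r d hd => ?_, fun M => ?_, fun M => ?_⟩
  · obtain ⟨s⟩ := hG.nonempty_split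
    obtain ⟨r, -⟩ := s.exists_run hG.isEdgeConnected_two h3
    exact ⟨r⟩
  · have hd := r.admissible d hd
    exact ⟨hd.connected_insertion hG.isEdgeConnected_two h3,
      hd.isCubic_insertion hG.isEdgeConnected_two h3, Split.hasBridge_insertion d, by simp⟩
  · exact ⟨Split.growthBound M, fun V _ hN G hG h3 r =>
      r.le_numDistinctCycleEdges_extGraph hG.isEdgeConnected_two h3 hN⟩
  · refine ⟨Split.growthBound (M * labelBound + 4), fun ι V _ hN G hG h3 hiso r => ?_⟩
    refine exists_finset_output_not_iso (fun i => (hG i).isEdgeConnected_two) h3 hiso r fun i => ?_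
    exact Nat.le_of_add_le_add_right
      (((r i).le_numDistinctCycleEdges_extGraph (hG i).isEdgeConnected_two (h3 i) (hN i)).trans
        (r i).numDistinctCycleEdges_le_ncard_darts)

end Main

end BridgeConstruction

open BridgeConstruction in
theorem theorem4p3 :
    -- the construction can be carried out on every biconnected cubic graph
    (∀ (n : ℕ) (G : SimpleGraph (Fin n)), BridgeConstruction.IsBiconnected G →
      BridgeConstruction.IsCubic G → Nonempty (BridgeConstruction.Run G)) ∧
    -- whatever choices are made, it produces connected cubic bridge graphs on `n + 4` vertices
    (∀ (n : ℕ) (G : SimpleGraph (Fin n)), BridgeConstruction.IsBiconnected G →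
      BridgeConstruction.IsCubic G → ∀ r : BridgeConstruction.Run G, ∀ d ∈ r.darts,
        (r.output d).Connected ∧ BridgeConstruction.IsCubic (r.output d) ∧
          BridgeConstruction.HasBridge (r.output d) ∧ Nat.card (Fin n ⊕ Fin 4) = n + 4) ∧
    -- the number of pairwise distinct edges on cycles of `G₁'` grows without bound
    (∀ M : ℕ, ∃ N : ℕ, ∀ n ≥ N, ∀ G : SimpleGraph (Fin n), BridgeConstruction.IsBiconnected G →
      BridgeConstruction.IsCubic G → ∀ r : BridgeConstruction.Run G,
        M ≤ BridgeConstruction.numDistinctCycleEdges r.toSplit.extGraph) ∧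
    -- for `n` large, whatever choices are made, `M` graphs can be kept for every source graph
    -- so that all the graphs kept are pairwise non-isomorphic
    (∀ M : ℕ, ∃ N : ℕ, ∀ n ≥ N, ∀ (ι : Type) (G : ι → SimpleGraph (Fin n)),
      (∀ i, BridgeConstruction.IsBiconnected (G i)) →
      (∀ i, BridgeConstruction.IsCubic (G i)) →
      (∀ i j, i ≠ j → IsEmpty (G i ≃g G j)) →
      ∀ r : (i : ι) → BridgeConstruction.Run (G i),
        ∃ A : (i : ι) → Finset ((r i).toSplit.extGraph.Dart),
          (∀ i, ↑(A i) ⊆ (r i).darts ∧ (A i).card = M) ∧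
          (∀ i, ∀ d ∈ A i, ∀ d' ∈ A i, d ≠ d' →
            IsEmpty ((r i).output d ≃g (r i).output d')) ∧
          (∀ i j, i ≠ j → ∀ d ∈ A i, ∀ d' ∈ A j,
            IsEmpty ((r i).output d ≃g (r j).output d'))) := by
  obtain ⟨hrun, hout, hlarge, hsel⟩ := theorem4p3_general.{0, 0}
  exact ⟨fun n => hrun (Fin n), fun n => by simpa only [Nat.card_fin] using hout (Fin n),
    fun M => (hlarge M).imp fun N hN n hn => hN (Fin n) (by simpa using hn),
    fun M => (hsel M).imp fun N hN n hn ι => hN ι (fun _ => Fin n) (by simpa using fun _ => hn)⟩
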